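/- Theorem 1 (thm:dDistHS). A multilinear depth-$3$ circuit over a field $\mathbb F$ with $n$ variables and top fan-in $k$ is an expression $C(x)=\sum_{i=1}^k a_i\prod_{j=1}^{n_i}\ell_{ij}$, where $a_i\in\mathbb F$, every $\ell_{ij}=b_0+\sum_{r=1}^n b_rx_r$ is an affine linear polynomial over $\mathbb F$, and the polynomial computed at each gate is multilinear. Its $i$-th product gate induces a partition of $\{x_1,\dots,x_n\}$ whose parts (colors) consist of the variables of the single factors $\ell_{ij}$ (variables absent from the gate, which occur with coefficient $0$, may be placed arbitrarily). The circuit has $\delta$-distance if its product gates can be ordered so that the induced partitions $\mathcal P_1,\dots,\mathcal P_k$ satisfy: for every $i\in\{2,\dots,k\}$ and every color $Y_1\in\mathcal P_i$ there are colors $Y_2,\dots,Y_{\delta'}\in\mathcal P_i$ with $\delta'\le\delta$ such that, for each $j<i$, the set $Y_1\cup\dots\cup Y_{\delta'}$ is a union of colors of $\mathcal P_j$. For all $n,k,\delta\ge 1$ there is a hitting-set for the class of $n$-variate multilinear depth-$3$ circuits with top fan-in $k$ and $\delta$-distance that is computable in time $n^{O(\delta\log k)}$ (where, so that $n=1$ and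 $k=1$ are included, this is read as $(n+1)^{O(\delta\log_2(k+1))}$). More precisely, there are a constant $c$ and one program for a random access machine, both independent of $n,k,\delta$ and of the field, such that the following holds for $T=(n+1)^{c\,\delta\lfloor\log_2(k+1)\rfloor}$. Let $K$ be a field and let $\alpha_0,\alpha_1,\dots$ be a sequence in $K$, accessible to the program, whose first $T$ elements are distinct (so $|K|\ge T$). On input $(n,k,\delta)$ the program outputs, within $T$ steps (unit cost for ring operations in $K$, for fetching an $\alpha_i$, for copying, for addition and truncated subtraction of natural numbers, and for tests of natural numbers for zero), a list of points $H\subseteq K^n$ such that for every subfield $\mathbb F$ of $K$ and every $n$-variate multilinear depth-$3$ circuit $C$ over $\mathbb F$ with top fan-in $k$ and $\delta$-distance that computes a nonzero polynomial, there is $h\in H$ with $C(h)\ne 0$. (One may take $K=\mathbb F$ if $\mathbb F$ has at least $T$ elements, and an extension of $\mathbb F$ otherwise.) -/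

import Mathlib

universe u v

/-! ### Multilinear depth-3 circuits -/

/-- An affine-linear polynomial `b₀ + ∑ r, b r * x r` in `n` variables. -/
structure AffineForm (F : Type u) (n : ℕ) where
  const : F
  coeff : Fin n → F

namespace AffineForm

/-- The variables present in the affine form. -/
def vars {F : Type u} [Zero F] {n : ℕ} (l : AffineForm F n) : Set (Fin n) :=
  {r | l.coeff r ≠ 0}

noncomputable def toPoly {F : Type u} [CommSemiring F] {n : ℕ} (l : AffineForm F n) :
    MvPolynomial (Fin n) F :=
  MvPolynomial.C l.const + ∑ r, MvPolynomial.C (l.coeff r) * MvPolynomial.X r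

end AffineForm

/-- A depth-3 (`ΣΠΣ`) circuit `∑ i, a i * ∏ j, l i j` in `n` variables with top fan-in `k`.
The fan-ins of the product gates are arbitrary. -/
structure DepthThreeCircuit (F : Type u) (n k : ℕ) where
  weight : Fin k → F
  factors : Fin k → List (AffineForm F n)

/-- Every variable has degree at most one in every monomial. -/
def IsMultilinearPoly {F : Type u} [CommSemiring F] {n : ℕ} (f : MvPolynomial (Fin n) F) : Prop :=
  ∀ m ∈ f.support, ∀ r, m r ≤ 1

namespace DepthThreeCircuit

noncomputable def gatePoly {F : Type u} [CommSemiring F] {n k : ℕ} (C : DepthThreeCircuit F n k)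
    (i : Fin k) : MvPolynomial (Fin n) F :=
  ((C.factors i).map AffineForm.toPoly).prod

/-- The polynomial computed by the circuit. -/
noncomputable def toPoly {F : Type u} [CommSemiring F] {n k : ℕ} (C : DepthThreeCircuit F n k) :
    MvPolynomial (Fin n) F :=
  ∑ i, MvPolynomial.C (C.weight i) * C.gatePoly i

/-- The polynomial computed at every gate is multilinear (this is automatic at the bottom gates,
which compute affine forms). -/
def IsMultilinear {F : Type u} [CommSemiring F] {n k : ℕ} (C : DepthThreeCircuit F n k) : Prop :=
  (∀ i, IsMultilinearPoly (C.gatePoly i)) ∧ IsMultilinearPoly C.toPoly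

end DepthThreeCircuit

/-- The product gate with the given factors induces the partition `P` of the variables: the
variables of each factor lie in one color, and no color meets two of the factors.
If all variables occur in the gate, then `P` consists of the variable sets of the nonconstant
factors; a variable that does not occur in the gate may be put anywhere (it occurs with
coefficient zero). -/
def InducesPartition {F : Type u} [Zero F] {n : ℕ} (L : List (AffineForm F n))
    (P : Finpartition (Finset.univ : Finset (Fin n))) : Prop :=
  (∀ l ∈ L, l.vars.Nonempty → ∃ Y ∈ P.parts, l.vars ⊆ (Y : Set (Fin n))) ∧
  L.Pairwise fun l l' => ∀ Y ∈ P.parts,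
    ¬ ((l.vars ∩ (Y : Set (Fin n))).Nonempty ∧ (l'.vars ∩ (Y : Set (Fin n))).Nonempty)

/-- The partition sequence has distance at most `δ`: in every partition except the first, every
color `Y₁` belongs to a set `N` of at most `δ` colors whose union is, for each earlier partition,
a union of colors of that partition. -/
def PartitionDistanceLE {n k : ℕ}
    (P : Fin k → Finpartition (Finset.univ : Finset (Fin n))) (δ : ℕ) : Prop :=
  ∀ i : Fin k, 0 < i.val → ∀ Y₁ ∈ (P i).parts,
    ∃ N ⊆ (P i).parts, Y₁ ∈ N ∧ N.card ≤ δ ∧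
      ∀ j < i, ∃ Z ⊆ (P j).parts, Z.sup id = N.sup id

/-- The circuit has `δ`-distance: its product gates can be ordered to correspond to a partition
sequence of distance at most `δ`. -/
def DepthThreeCircuit.HasDistance {F : Type u} [Zero F] {n k : ℕ} (C : DepthThreeCircuit F n k)
    (δ : ℕ) : Prop :=
  ∃ (σ : Equiv.Perm (Fin k)) (P : Fin k → Finpartition (Finset.univ : Finset (Fin n))),
    (∀ i, InducesPartition (C.factors (σ i)) (P i)) ∧ PartitionDistanceLE P δ

/-- A set `H` of points with coordinates in `K` is a hitting-set for the `n`-variate multilinear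
depth-3 circuits over `F` with top fan-in `k` and `δ`-distance: every such circuit that computes
a nonzero polynomial is nonzero at some point of `H`. -/
def IsHittingSet (F : Type u) [Field F] {K : Type v} [Field K] [Algebra F K] {n : ℕ} (k δ : ℕ)
    (H : Set (Fin n → K)) : Prop :=
  ∀ C : DepthThreeCircuit F n k, C.IsMultilinear → C.HasDistance δ → C.toPoly ≠ 0 →
    ∃ x ∈ H, MvPolynomial.aeval x C.toPoly ≠ 0

/-! ### Random access machines with field registers -/

/-- Programs of a random access machine with a memory of natural numbers, a memory of field
elements, and a write-only output tape of field elements. Programs mention no field. -/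
inductive RamProg : Type
  /-- `N[r] := c` -/
  | const (r c : ℕ)
  /-- `N[r] := N[s] + N[t]` -/
  | add (r s t : ℕ)
  /-- `N[r] := N[s] - N[t]`, truncated at zero -/
  | sub (r s t : ℕ)
  /-- `N[r] := N[N[s]]` -/
  | load (r s : ℕ)
  /-- `N[N[r]] := N[s]` -/
  | store (r s : ℕ)
  /-- `A[r] := 0` -/
  | fzero (r : ℕ)
  /-- `A[r] := 1` -/
  | fone (r : ℕ)
  /-- `A[r] := α N[s]`, where `α` is the given enumeration of field elements -/
  | felem (r s : ℕ)
  /-- `A[r] := A[s] + A[t]` -/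
  | fadd (r s t : ℕ)
  /-- `A[r] := A[s] - A[t]` -/
  | fsub (r s t : ℕ)
  /-- `A[r] := A[s] * A[t]` -/
  | fmul (r s t : ℕ)
  /-- `A[r] := A[N[s]]` -/
  | fload (r s : ℕ)
  /-- `A[N[r]] := A[s]` -/
  | fstore (r s : ℕ)
  /-- append `A[r]` to the output -/
  | emit (r : ℕ)
  /-- first `p`, then `q` -/
  | seq (p q : RamProg)
  /-- if `N[r] = 0` then `p`, else `q` -/
  | ifZero (r : ℕ) (p q : RamProg)
  /-- while `N[r] ≠ 0` do `p` -/
  | whileNonzero (r : ℕ) (p : RamProg)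

structure RamState (K : Type v) where
  N : ℕ → ℕ
  A : ℕ → K
  out : List K

/-- The state in which a computation on the input `(n, k, δ)` starts. -/
def RamState.initial (K : Type v) [Zero K] (n k δ : ℕ) : RamState K where
  N := fun i => if i = 0 then n else if i = 1 then k else if i = 2 then δ else 0
  A := fun _ => 0
  out := []

/-- `RamExec α p s t s'`: the program `p`, started in the state `s`, halts in the state `s'` after
exactly `t` steps. Every instruction and every test of a register takes one step. There is no
multiplication of natural numbers. -/
inductive RamExec {K : Type v} [Field K] (α : ℕ → K) :
    RamProg → RamState K → ℕ → RamState K → Prop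
  | const (r c : ℕ) (s : RamState K) :
      RamExec α (.const r c) s 1 { s with N := Function.update s.N r c }
  | add (r a b : ℕ) (s : RamState K) :
      RamExec α (.add r a b) s 1 { s with N := Function.update s.N r (s.N a + s.N b) }
  | sub (r a b : ℕ) (s : RamState K) :
      RamExec α (.sub r a b) s 1 { s with N := Function.update s.N r (s.N a - s.N b) }
  | load (r a : ℕ) (s : RamState K) :
      RamExec α (.load r a) s 1 { s with N := Function.update s.N r (s.N (s.N a)) }
  | store (r a : ℕ) (s : RamState K) :
      RamExec α (.store r a) s 1 { s with N := Function.update s.N (s.N r) (s.N a) }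
  | fzero (r : ℕ) (s : RamState K) :
      RamExec α (.fzero r) s 1 { s with A := Function.update s.A r 0 }
  | fone (r : ℕ) (s : RamState K) :
      RamExec α (.fone r) s 1 { s with A := Function.update s.A r 1 }
  | felem (r a : ℕ) (s : RamState K) :
      RamExec α (.felem r a) s 1 { s with A := Function.update s.A r (α (s.N a)) }
  | fadd (r a b : ℕ) (s : RamState K) :
      RamExec α (.fadd r a b) s 1 { s with A := Function.update s.A r (s.A a + s.A b) }
  | fsub (r a b : ℕ) (s : RamState K) :
      RamExec α (.fsub r a b) s 1 { s with A := Function.update s.A r (s.A a - s.A b) }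
  | fmul (r a b : ℕ) (s : RamState K) :
      RamExec α (.fmul r a b) s 1 { s with A := Function.update s.A r (s.A a * s.A b) }
  | fload (r a : ℕ) (s : RamState K) :
      RamExec α (.fload r a) s 1 { s with A := Function.update s.A r (s.A (s.N a)) }
  | fstore (r a : ℕ) (s : RamState K) :
      RamExec α (.fstore r a) s 1 { s with A := Function.update s.A (s.N r) (s.A a) }
  | emit (r : ℕ) (s : RamState K) :
      RamExec α (.emit r) s 1 { s with out := s.out ++ [s.A r] }
  | seq {p q : RamProg} {s s' s'' : RamState K} {t t' : ℕ} :
      RamExec α p s t s' → RamExec α q s' t' s'' → RamExec α (.seq p q) s (t + t') s''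
  | ifZero_zero {r : ℕ} {p q : RamProg} {s s' : RamState K} {t : ℕ} :
      s.N r = 0 → RamExec α p s t s' → RamExec α (.ifZero r p q) s (t + 1) s'
  | ifZero_pos {r : ℕ} {p q : RamProg} {s s' : RamState K} {t : ℕ} :
      s.N r ≠ 0 → RamExec α q s t s' → RamExec α (.ifZero r p q) s (t + 1) s'
  | whileNonzero_zero {r : ℕ} {p : RamProg} {s : RamState K} :
      s.N r = 0 → RamExec α (.whileNonzero r p) s 1 s
  | whileNonzero_pos {r : ℕ} {p : RamProg} {s s' s'' : RamState K} {t t' : ℕ} :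
      s.N r ≠ 0 → RamExec α p s t s' → RamExec α (.whileNonzero r p) s' t' s'' →
      RamExec α (.whileNonzero r p) s (t + t' + 1) s''

/-- On the input `(n, k, δ)` and with the enumeration `α`, the program halts within `T` steps,
and its output is the list of the coordinates of the points in `H`, point after point. -/
def OutputsPointsWithin {K : Type v} [Field K] (α : ℕ → K) (p : RamProg) (n k δ T : ℕ)
    (H : List (Fin n → K)) : Prop :=
  ∃ (t : ℕ) (s : RamState K), t ≤ T ∧ RamExec α p (RamState.initial K n k δ) t s ∧
    s.out = (H.map List.ofFn).flatten

/-! Let `joinLabel P i` label the parts of the finest common coarsening of the first partitions up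
to index `i`. These joins get coarser as `i` grows. The `i`-th gate is a product along the parts of
its join. The set `N` supplied by the distance condition has a union that is saturated for all
partitions up to `i`. So a part of the join lies inside at most `δ` colors, and the gate has degree
at most `δ` in each part (`factorsAlong_listCoeff`). What remains is a statement about sums of such
products along a chain of partitions.

The core is low-support concentration. After the shift `x_r ↦ x_r + X ^ w r`, a nonzero sum of `k <
2 ^ h` gates has a nonzero coefficient at a monomial in only `O(δ h)` variables. If all gates share
one partition, this is rank concentration (`isolation`, `shiftCoeff_eq_zero_of_factorsAlong`): a
minimal-support obstruction would produce `2 ^ m` linearly independent vectors in a space of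
dimension `k`. For a chain of `2 ^ h` partitions, the chain is halved
(`sum_eq_zero_of_shiftCoeff_eq_zero`). Differentiating by `δ + 1` variables in one part of the
middle partition kills every gate of the coarser half, so induction handles the derivatives. If they
all vanish, the sum has degree at most `δ` in each middle part, and truncating every gate to such
monomials preserves the sum. Truncated finer gates are products along the middle partition, so the
finer half of the chain is no longer needed. Each halving costs `δ + 1` variables of support.

The weights need only separate sets of `O(δ h)` variables. Taking `2 ^ r` modulo a suitable small
`p` achieves this (`exists_separating_modulus`), and all moduli can be tried. For the right weights,
the points `a ^ w r + b * c ^ w r` expose a low-support coefficient: `a` keeps it nonzero, `c`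
separates sets of one size, and `b` separates sizes (`exists_curve_point_ne_zero`). The program
enumerates the modulus and `a`, `b`, `c`. -/

/-! ### Weight isolation for vectors of coefficients -/

open Polynomial in
/-- The coefficients of a multilinear polynomial with coefficients `f` after the substitution
`x_r ↦ x_r + X ^ w r` for the variables `r ∈ B`. -/
noncomputable def shiftCoeff {σ K : Type*} [DecidableEq σ] [Field K] (w : σ → ℕ) (B : Finset σ)
    (f : Finset σ → K[X]) (S : Finset σ) : K[X] :=
  ∑ V ∈ (B \ S).powerset, f (S ∪ V) * X ^ (∑ r ∈ V, w r)

/-- A coefficient function of a multilinear polynomial that is a product along the partition with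
labels `q`, of degree at most `δ` in each part. -/
structure FactorsAlong {σ κ K : Type*} [DecidableEq σ] [DecidableEq κ] [Field K] (q : σ → κ)
    (δ : ℕ) (G : Finset σ → K) : Prop where
  split : ∀ A : Finset σ, (∀ r r', q r = q r' → r ∈ A → r' ∈ A) →
    ∃ P Q : Finset σ → K, ∀ U, G U = P (U ∩ A) * Q (U \ A)
  degree_le : ∀ U, G U ≠ 0 → ∀ a, (U.filter (q · = a)).card ≤ δ

/-- A set that meets no line in exactly one point is at least as large as a cube: moving in the
direction of one block gives two different traces on that block, and the points with either trace
satisfy the hypothesis for the remaining blocks. -/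
theorem two_pow_card_le_of_lines {σ κ : Type*} [DecidableEq σ] [DecidableEq κ]
    (A : κ → Finset σ) (J : Finset κ) (hA : ∀ i ∈ J, ∀ j ∈ J, i ≠ j → Disjoint (A i) (A j))
    (E : Finset (Finset σ)) (hE : E.Nonempty)
    (hline : ∀ j ∈ J, ∀ α ∈ E, ∃ β ∈ E, β ≠ α ∧ β \ A j = α \ A j) :
    2 ^ J.card ≤ E.card := by
  induction J using Finset.induction_on generalizing E with
  | empty => simpa using hE.card_pos
  | insert i J hi ih =>
    obtain ⟨α, hα⟩ := hE
    obtain ⟨β, hβ, hne, hd⟩ := hline i (by simp) α hα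
    have hdiff : β ∩ A i ≠ α ∩ A i := fun h => hne <| by
      rw [← Finset.sdiff_union_inter β (A i), h, hd, Finset.sdiff_union_inter]
    have key : ∀ γ ∈ E, 2 ^ J.card ≤ (E.filter (fun x => x ∩ A i = γ ∩ A i)).card := by
      intro γ hγ
      refine ih (fun a ha b hb => hA a (by simp [ha]) b (by simp [hb])) _ ⟨γ, by simp [hγ]⟩ ?_
      intro j hj x hx
      rw [Finset.mem_filter] at hx
      obtain ⟨y, hy, hyne, hyd⟩ := hline j (by simp [hj]) x hx.1
      refine ⟨y, Finset.mem_filter.2 ⟨hy, ?_⟩, hyne, hyd⟩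
      rw [← hx.2]
      have hdis : Disjoint (A i) (A j) :=
        hA i (by simp) j (by simp [hj]) (by rintro rfl; exact hi hj)
      ext r
      have h1 := Finset.ext_iff.1 hyd r
      simp only [Finset.mem_sdiff, Finset.mem_inter] at h1 ⊢
      constructor
      · rintro ⟨h2, h3⟩
        have := Finset.disjoint_left.1 hdis h3
        tauto
      · rintro ⟨h2, h3⟩
        have := Finset.disjoint_left.1 hdis h3
        tauto
    have h1 := key α hα
    have h2 := key β hβ
    rw [Finset.card_insert_of_notMem hi, pow_succ, mul_two]
    refine (Nat.add_le_add h1 h2).trans ?_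
    rw [← Finset.card_union_of_disjoint]
    · exact Finset.card_le_card (by intro x; simp; tauto)
    · rw [Finset.disjoint_left]
      intro x hx hy
      rw [Finset.mem_filter] at hx hy
      exact hdiff (hy.2.symm.trans hx.2)

open Polynomial in
/-- Isolation of monomials by weights: a combination of fewer than `2 ^ m` polynomials, with
coefficients depending on `X`, that vanishes whenever the variables of one of `m` blocks are
specialized to powers of `X`, is zero. -/
theorem isolation {σ κ ι K : Type*} [DecidableEq σ] [DecidableEq κ] [Fintype ι] [Field K]
    (w : σ → ℕ) (A : κ → Finset σ) (J : Finset κ)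
    (hA : ∀ i ∈ J, ∀ j ∈ J, i ≠ j → Disjoint (A i) (A j)) (hcard : Fintype.card ι < 2 ^ J.card)
    (c : ι → K[X]) (P : ι → Finset σ → K) (b : Finset σ → K[X])
    (hb : ∀ α, b α = ∑ i, c i * C (P i α)) (s : Finset (Finset σ))
    (hinj : ∀ U ∈ s, ∀ V ∈ s, ∑ r ∈ U, w r = ∑ r ∈ V, w r → U = V)
    (hline : ∀ j ∈ J, ∀ α ∈ s,
      ∑ V ∈ (A j).powerset, b (α \ A j ∪ V) * X ^ (∑ r ∈ V, w r) = 0)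
    (hout : ∀ j ∈ J, ∀ α ∈ s, ∀ V ⊆ A j, α \ A j ∪ V ∉ s → b (α \ A j ∪ V) = 0) :
    ∀ α ∈ s, b α = 0 := by
  classical
  by_contra! hcon
  obtain ⟨α₀, hα₀, hne₀⟩ := hcon
  -- With this weight the hypothesis on lines says that `g` sums to zero over each line, up to a
  -- common power of `X`.
  let g : Finset σ → K[X] := fun α => b α * X ^ (∑ r ∈ α, w r)
  obtain ⟨α₁, hα₁, hmax⟩ := (s.filter (fun α => b α ≠ 0)).exists_max_image
    (fun α => (g α).natDegree) ⟨α₀, by simp [hα₀, hne₀]⟩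
  rw [Finset.mem_filter] at hα₁
  set M := (g α₁).natDegree with hM
  have hdeg : ∀ α ∈ s, (g α).natDegree ≤ M := by
    intro α hα
    by_cases h : b α = 0
    · simp [g, h]
    · exact hmax α (by simp [hα, h])
  let E := s.filter (fun α => (g α).coeff M ≠ 0)
  have hEne : E.Nonempty := by
    refine ⟨α₁, Finset.mem_filter.2 ⟨hα₁.1, ?_⟩⟩
    have : g α₁ ≠ 0 := mul_ne_zero hα₁.2 (pow_ne_zero _ X_ne_zero)
    simpa [hM] using this
  have hlines : 2 ^ J.card ≤ E.card := by
    refine two_pow_card_le_of_lines A J hA E hEne ?_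
    intro j hj α hα
    rw [Finset.mem_filter] at hα
    -- The coefficients of `X ^ M` cancel along the line, so a point of `E` cannot be alone on it.
    have hsum : ∑ V ∈ (A j).powerset, (g (α \ A j ∪ V)).coeff M = 0 := by
      have h := congrArg (fun p => (p * X ^ (∑ r ∈ α \ A j, w r)).coeff M) (hline j hj α hα.1)
      simp only [zero_mul, coeff_zero] at h
      rw [← h, Finset.sum_mul, finsetSum_coeff]
      refine Finset.sum_congr rfl fun V hV => ?_
      have hdis : Disjoint (α \ A j) V :=
        Finset.disjoint_of_subset_right (Finset.mem_powerset.1 hV) Finset.sdiff_disjoint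
      simp only [g]
      rw [Finset.sum_union hdis, mul_assoc, ← pow_add, add_comm]
    have hmem : α ∩ A j ∈ (A j).powerset := by simp
    rw [← Finset.add_sum_erase _ _ hmem, Finset.sdiff_union_inter] at hsum
    obtain ⟨V, hV, hVne⟩ : ∃ V ∈ (A j).powerset.erase (α ∩ A j),
        (g (α \ A j ∪ V)).coeff M ≠ 0 := by
      by_contra! h
      rw [Finset.sum_eq_zero h, add_zero] at hsum
      exact hα.2 hsum
    rw [Finset.mem_erase, Finset.mem_powerset] at hV
    refine ⟨α \ A j ∪ V, Finset.mem_filter.2 ⟨?_, hVne⟩, ?_, ?_⟩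
    · by_contra h
      exact hVne (by simp [g, hout j hj α hα.1 V hV.2 h])
    · intro h
      apply hV.1
      rw [← h]
      ext r
      have := @hV.2 r
      simp only [Finset.mem_inter, Finset.mem_union, Finset.mem_sdiff]
      tauto
    · ext r
      have := @hV.2 r
      simp only [Finset.mem_union, Finset.mem_sdiff]
      tauto
  -- The rows indexed by `E` are independent. In a dependency, take the row `γ` of least weight and
  -- compare coefficients of `X` to the power `M` minus that weight. Every other row involved has
  -- larger weight, hence `b` of degree too small to contribute.
  have hind : LinearIndependent K (fun γ : E => fun i => P i γ.1) := by
    rw [Fintype.linearIndependent_iff]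
    intro d hd
    by_contra! hcon
    obtain ⟨γ₀, hγ₀⟩ := hcon
    obtain ⟨γ, hγ, hmin⟩ := (Finset.univ.filter (fun γ : E => d γ ≠ 0)).exists_min_image
      (fun γ => ∑ r ∈ γ.1, w r) ⟨γ₀, by simp [hγ₀]⟩
    simp only [Finset.mem_filter, Finset.mem_univ, true_and] at hγ hmin
    have hγE := Finset.mem_filter.1 γ.2
    have hwM : ∑ r ∈ γ.1, w r ≤ M := by
      by_contra h
      exact hγE.2 (by simp only [g]; rw [coeff_mul_X_pow', if_neg h])
    have hco : ∀ α, ∑ i, (c i).coeff (M - ∑ r ∈ γ.1, w r) * P i α =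
        (b α).coeff (M - ∑ r ∈ γ.1, w r) := by
      intro α
      rw [hb, finsetSum_coeff]
      simp
    have hz : ∑ β : E, d β * (b β.1).coeff (M - ∑ r ∈ γ.1, w r) = 0 := by
      simp_rw [← hco, Finset.mul_sum]
      rw [Finset.sum_comm]
      refine Finset.sum_eq_zero fun i _ => ?_
      have := congrFun hd i
      simp only [Finset.sum_apply, Pi.smul_apply, smul_eq_mul, Pi.zero_apply] at this
      rw [← mul_zero ((c i).coeff (M - ∑ r ∈ γ.1, w r)), ← this, Finset.mul_sum]
      exact Finset.sum_congr rfl fun β _ => by ring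
    rw [Finset.sum_eq_single γ] at hz
    · have h2 := hγE.2
      simp only [g] at h2
      rw [coeff_mul_X_pow', if_pos hwM] at h2
      exact (mul_ne_zero hγ h2) hz
    · intro β _ hβγ
      by_cases hdβ : d β = 0
      · simp [hdβ]
      have hβE := Finset.mem_filter.1 β.2
      have hlt : ∑ r ∈ γ.1, w r < ∑ r ∈ β.1, w r := by
        refine lt_of_le_of_ne (hmin β hdβ) fun h => hβγ ?_
        exact Subtype.ext (hinj _ hβE.1 _ hγE.1 h.symm)
      have hb0 : b β.1 ≠ 0 := fun h => hβE.2 (by simp [g, h])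
      have hdg : (b β.1).natDegree + ∑ r ∈ β.1, w r ≤ M := by
        have := hdeg β.1 hβE.1
        simp only [g] at this
        rwa [natDegree_mul_X_pow _ hb0] at this
      rw [coeff_eq_zero_of_natDegree_lt (by omega), mul_zero]
    · simp
  have := hind.fintype_card_le_finrank
  simp only [Fintype.card_coe, Module.finrank_fintype_fun_eq_card] at this
  omega

theorem sum_powerset_union_of_disjoint {σ M : Type*} [DecidableEq σ] [AddCommMonoid M]
    {B D : Finset σ} (h : Disjoint B D) (g : Finset σ → M) :
    ∑ V ∈ (B ∪ D).powerset, g V = ∑ V ∈ B.powerset, ∑ W ∈ D.powerset, g (V ∪ W) := by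
  rw [← Finset.sum_product']
  symm
  refine Finset.sum_nbij' (fun p => p.1 ∪ p.2) (fun V => (V ∩ B, V ∩ D)) ?_ ?_ ?_ ?_ ?_
  · rintro ⟨V, W⟩ hp
    simp only [Finset.mem_product, Finset.mem_powerset] at hp ⊢
    exact Finset.union_subset_union hp.1 hp.2
  · intro V _
    simp
  · rintro ⟨V, W⟩ hp
    simp only [Finset.mem_product, Finset.mem_powerset] at hp
    have hd := Finset.disjoint_left.1 h
    ext r <;> have h1 := @hp.1 r <;> have h2 := @hp.2 r <;> have h3 := @hd r <;>
      simp only [Finset.mem_inter, Finset.mem_union] <;> tauto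
  · intro V hV
    rw [Finset.mem_powerset] at hV
    simp only
    rw [← Finset.inter_union_distrib_left, Finset.inter_eq_left.2 hV]
  · intro _ _
    rfl

/-! ### Shifts, and concentration for a single partition -/

section Shift

variable {σ K : Type*} [DecidableEq σ] [Field K] (w : σ → ℕ) (f : Finset σ → Polynomial K)

theorem shiftCoeff_shiftCoeff {B D : Finset σ} (h : Disjoint B D) (S : Finset σ) :
    shiftCoeff w B (shiftCoeff w D f) S = shiftCoeff w (B ∪ D) f S := by
  unfold shiftCoeff
  rw [Finset.union_sdiff_distrib, sum_powerset_union_of_disjoint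
    (Finset.disjoint_of_subset_left Finset.sdiff_subset
      (Finset.disjoint_of_subset_right Finset.sdiff_subset h))]
  refine Finset.sum_congr rfl fun V hV => ?_
  rw [Finset.mem_powerset, Finset.subset_sdiff] at hV
  have hDV : Disjoint D V := (Finset.disjoint_of_subset_left hV.1 h).symm
  have hD : D \ (S ∪ V) = D \ S := by
    rw [Finset.sdiff_union_distrib, Finset.sdiff_eq_self_of_disjoint hDV]
    exact Finset.inter_eq_left.2 Finset.sdiff_subset
  rw [hD, Finset.sum_mul]
  refine Finset.sum_congr rfl fun W hW => ?_
  rw [Finset.mem_powerset] at hW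
  have hVW : Disjoint V W := Finset.disjoint_of_subset_right (hW.trans Finset.sdiff_subset) hDV.symm
  rw [Finset.sum_union hVW, pow_add, Finset.union_assoc]
  ring

/-- A shift is unitriangular with respect to inclusion: the coefficient at `R ∪ β` changes only by
multiples of coefficients at larger sets. So it can be inverted from the largest `β` downwards. -/
theorem eq_zero_of_shiftCoeff_eq_zero {B R : Finset σ}
    (h : ∀ β ⊆ B, shiftCoeff w B f (R ∪ β) = 0) : ∀ β ⊆ B, f (R ∪ β) = 0 := by
  intro β hβ
  induction hm : (B \ β).card using Nat.strong_induction_on generalizing β with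
  | _ m ih =>
    have h1 := h β hβ
    unfold shiftCoeff at h1
    rw [Finset.sum_eq_single ∅] at h1
    · simpa using h1
    · intro V hV hne
      rw [Finset.mem_powerset] at hV
      have hVB : V ⊆ B \ β := hV.trans (Finset.sdiff_subset_sdiff le_rfl Finset.subset_union_right)
      rw [Finset.union_assoc, ih _ _ (β ∪ V)
        (Finset.union_subset hβ (hVB.trans Finset.sdiff_subset)) rfl, zero_mul]
      rw [← hm]
      apply Finset.card_lt_card
      rw [Finset.ssubset_iff_of_subset (Finset.sdiff_subset_sdiff le_rfl Finset.subset_union_left)]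
      obtain ⟨r, hr⟩ := Finset.nonempty_iff_ne_empty.2 hne
      exact ⟨r, hVB hr, by simp [hr]⟩
    · simp

end Shift

set_option maxHeartbeats 1000000 in
open Polynomial in
-- Induction on the number of parts that `S` meets. If there are at least `m`, single out `m` of
-- them and shift only the variables outside. The coefficients in the `m` blocks then have the form
-- required by `isolation`. Shifting one more block sends its line sums to coefficients that avoid
-- this block, which the induction controls.
theorem shiftCoeff_eq_zero_of_factorsAlong {σ κ ι K : Type*} [DecidableEq σ] [Fintype σ]
    [DecidableEq κ] [Fintype ι] [Field K] (w : σ → ℕ) {q : σ → κ} {δ m : ℕ}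
    (hw : ∀ U V : Finset σ, U.card ≤ δ * m → V.card ≤ δ * m →
      ∑ r ∈ U, w r = ∑ r ∈ V, w r → U = V)
    (hι : Fintype.card ι < 2 ^ m) {G : ι → Finset σ → K} (hG : ∀ i, FactorsAlong q δ (G i))
    (h0 : ∀ T : Finset σ, T.card ≤ δ * m →
      shiftCoeff w Finset.univ (fun U => C (∑ i, G i U)) T = 0) (S : Finset σ) :
    shiftCoeff w Finset.univ (fun U => C (∑ i, G i U)) S = 0 := by
  induction hc : (S.image q).card using Nat.strong_induction_on generalizing S with
  | _ d ih =>
  subst hc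
  set f : Finset σ → K[X] := fun U => C (∑ i, G i U) with hf
  have hfdeg : ∀ U, f U ≠ 0 → ∀ a, (U.filter (q · = a)).card ≤ δ := by
    intro U hU
    obtain ⟨i, -, hi⟩ := Finset.exists_ne_zero_of_sum_ne_zero
      (show ∑ i, G i U ≠ 0 from fun h => hU (by simp only [hf, h, map_zero]))
    exact (hG i).degree_le U hi
  by_contra hS
  -- Otherwise `S` meets fewer than `m` parts, each in at most `δ` elements, since some coefficient
  -- above `S` is nonzero. It is then small enough for `h0`.
  have hm : m ≤ (S.image q).card := by
    by_contra hlt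
    refine hS (h0 S ?_)
    obtain ⟨V, -, hV⟩ := Finset.exists_ne_zero_of_sum_ne_zero hS
    have hV := hfdeg _ (left_ne_zero_of_mul hV)
    refine (Finset.card_le_mul_card_image (f := q) S δ fun a _ => ?_).trans
      (Nat.mul_le_mul_left _ (by omega))
    exact (Finset.card_le_card
      (Finset.filter_subset_filter _ Finset.subset_union_left)).trans (hV a)
  obtain ⟨J, hJS, hJ⟩ := Finset.exists_subset_card_eq hm
  let block : κ → Finset σ := fun a => Finset.univ.filter (q · = a)
  let A : Finset σ := Finset.univ.filter (q · ∈ J)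
  have hmemA : ∀ r, r ∈ A ↔ q r ∈ J := by simp [A]
  have hmemb : ∀ a r, r ∈ block a ↔ q r = a := by simp [block]
  have hblock : ∀ a ∈ J, block a ⊆ A := by
    intro a ha r hr
    rw [hmemA, (hmemb a r).1 hr]
    exact ha
  let R := S \ A
  have hsplit : ∀ i, ∃ P Q : Finset σ → K, ∀ U, G i U = P (U ∩ A) * Q (U \ A) := fun i =>
    (hG i).split A fun r r' h hr => by rw [hmemA] at hr ⊢; rwa [← h]
  choose P Q hPQ using hsplit
  let c : ι → K[X] := fun i =>
    ∑ V ∈ (Aᶜ \ R).powerset, C (Q i (R ∪ V)) * X ^ (∑ r ∈ V, w r)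
  let b : Finset σ → K[X] := fun α => ∑ i, c i * C (P i α)
  have hRA : ∀ r, r ∈ R → r ∉ A := fun r hr => (Finset.mem_sdiff.1 hr).2
  have hshift : ∀ α ⊆ A, shiftCoeff w Aᶜ f (R ∪ α) = b α := by
    intro α hα
    have hset : Aᶜ \ (R ∪ α) = Aᶜ \ R := by
      ext r
      have := @hα r
      simp only [Finset.mem_sdiff, Finset.mem_compl, Finset.mem_union]
      tauto
    simp only [b, c, shiftCoeff, hset, Finset.sum_mul]
    rw [Finset.sum_comm]
    refine Finset.sum_congr rfl fun V hV => ?_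
    have h1 : (R ∪ α ∪ V) ∩ A = α := by
      ext r
      have h1 := @hα r
      have h2 : r ∈ V → r ∈ Aᶜ \ R := fun h => Finset.mem_powerset.1 hV h
      have h3 := hRA r
      simp only [Finset.mem_inter, Finset.mem_union, Finset.mem_sdiff, Finset.mem_compl] at h2 ⊢
      tauto
    have h2 : (R ∪ α ∪ V) \ A = R ∪ V := by
      ext r
      have h1 := @hα r
      have h2 : r ∈ V → r ∈ Aᶜ \ R := fun h => Finset.mem_powerset.1 hV h
      have h3 := hRA r
      simp only [Finset.mem_union, Finset.mem_sdiff, Finset.mem_compl] at h2 ⊢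
      tauto
    simp only [hf, hPQ, h1, h2, map_sum, map_mul, Finset.sum_mul]
    exact Finset.sum_congr rfl fun i _ => by ring
  -- Only these sets can carry a nonzero `b`. They have at most `δ * m` elements, so their weights
  -- are distinct.
  let s := A.powerset.filter (fun α => ∀ a ∈ J, (α.filter (q · = a)).card ≤ δ)
  have hs : ∀ α ⊆ A, α ∉ s → b α = 0 := by
    intro α hα hαs
    rw [← hshift α hα]
    refine Finset.sum_eq_zero fun V _ => ?_
    by_contra hne
    have hd := hfdeg _ (left_ne_zero_of_mul hne)
    refine hαs (Finset.mem_filter.2 ⟨Finset.mem_powerset.2 hα, fun a _ => ?_⟩)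
    refine (Finset.card_le_card (Finset.filter_subset_filter _ ?_)).trans (hd a)
    exact Finset.subset_union_right.trans Finset.subset_union_left
  have hsub : ∀ j ∈ J, ∀ α ⊆ A, ∀ V ⊆ block j, α \ block j ∪ V ⊆ A := fun j hj α hα V hV =>
    Finset.union_subset (Finset.sdiff_subset.trans hα) (hV.trans (hblock j hj))
  have hscard : ∀ α ∈ s, α.card ≤ δ * m := by
    intro α hα
    rw [Finset.mem_filter, Finset.mem_powerset] at hα
    have himg : α.image q ⊆ J := by
      intro a ha
      obtain ⟨r, hr, rfl⟩ := Finset.mem_image.1 ha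
      exact (hmemA r).1 (hα.1 hr)
    rw [← hJ]
    exact (Finset.card_le_mul_card_image (f := q) α δ fun a ha => hα.2 a (himg ha)).trans
      (Nat.mul_le_mul_left _ (Finset.card_le_card himg))
  have hball : ∀ α ⊆ A, b α = 0 := by
    have hiso := isolation w block J ?_ (by rwa [hJ]) c P b (fun _ => rfl) s
      (fun U hU V hV => hw U V (hscard U hU) (hscard V hV)) ?_ ?_
    · intro α hα
      by_cases h : α ∈ s
      · exact hiso α h
      · exact hs α hα h
    · intro i _ j _ hij
      rw [Finset.disjoint_left]
      intro r hr hr'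
      rw [hmemb] at hr hr'
      exact hij (hr.symm.trans hr')
    · intro j hj α hα
      have hαA : α ⊆ A := Finset.mem_powerset.1 (Finset.mem_filter.1 hα).1
      -- A line sum is a coefficient after shifting everything but `A \ block j`. It vanishes once
      -- the coefficients of the full shift do, because the missing shift is invertible.
      have e1 : ∑ V ∈ (block j).powerset, b (α \ block j ∪ V) * X ^ (∑ r ∈ V, w r) =
          shiftCoeff w (block j) (shiftCoeff w Aᶜ f) (R ∪ α \ block j) := by
        have hset : block j \ (R ∪ α \ block j) = block j := by
          ext r
          have h1 := @hblock j hj r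
          have h3 := hRA r
          simp only [Finset.mem_sdiff, Finset.mem_union]
          tauto
        rw [shiftCoeff, hset]
        refine Finset.sum_congr rfl fun V hV => ?_
        rw [Finset.union_assoc, hshift _ (hsub j hj α hαA V (Finset.mem_powerset.1 hV))]
      have hdis : Disjoint (block j) Aᶜ := by
        rw [Finset.disjoint_left]
        intro r hr
        simpa using hblock j hj hr
      rw [e1, shiftCoeff_shiftCoeff _ _ hdis]
      refine eq_zero_of_shiftCoeff_eq_zero w _ (B := A \ block j) (R := R) ?_ _
        (Finset.sdiff_subset_sdiff hαA le_rfl)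
      intro β hβ
      rw [shiftCoeff_shiftCoeff]
      · have hun : A \ block j ∪ (block j ∪ Aᶜ) = Finset.univ := by
          ext r
          simp only [Finset.mem_union, Finset.mem_sdiff, Finset.mem_compl, Finset.mem_univ]
          tauto
        rw [hun]
        -- The set `R ∪ β` meets only parts met by `S`, and it misses the part `j`.
        refine ih _ ?_ _ rfl
        apply Finset.card_lt_card
        refine (Finset.ssubset_iff_of_subset ?_).2 ⟨j, hJS hj, ?_⟩
        · intro a ha
          obtain ⟨r, hr, rfl⟩ := Finset.mem_image.1 ha
          rcases Finset.mem_union.1 hr with h | h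
          · exact Finset.mem_image_of_mem _ (Finset.sdiff_subset h)
          · exact hJS ((hmemA r).1 (Finset.sdiff_subset (hβ h)))
        · intro ha
          obtain ⟨r, hr, hrj⟩ := Finset.mem_image.1 ha
          rcases Finset.mem_union.1 hr with h | h
          · exact hRA r h ((hmemA r).2 (hrj ▸ hj))
          · exact (Finset.mem_sdiff.1 (hβ h)).2 ((hmemb j r).2 hrj)
      · rw [Finset.disjoint_left]
        intro r hr
        simp only [Finset.mem_union, Finset.mem_sdiff, Finset.mem_compl] at hr ⊢
        tauto
    · intro j hj α hα V hV hn
      exact hs _ (hsub j hj α (Finset.mem_powerset.1 (Finset.mem_filter.1 hα).1) V hV) hn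
  apply hS
  have huniv : (Finset.univ : Finset σ) = A ∪ Aᶜ := (Finset.union_compl A).symm
  rw [huniv, ← shiftCoeff_shiftCoeff w f disjoint_compl_right]
  refine Finset.sum_eq_zero fun V hV => ?_
  have hVA : V ⊆ A := (Finset.mem_powerset.1 hV).trans Finset.sdiff_subset
  have hset : S ∪ V = R ∪ (S ∩ A ∪ V) := by
    rw [← Finset.union_assoc, Finset.sdiff_union_inter]
  have hαA : S ∩ A ∪ V ⊆ A := Finset.union_subset Finset.inter_subset_right hVA
  rw [hset, hshift _ hαA, hball _ hαA, zero_mul]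

/-! ### Concentration along a chain of partitions -/

namespace FactorsAlong

variable {σ κ K : Type*} [DecidableEq σ] [DecidableEq κ] [Field K] {q : σ → κ} {δ : ℕ}
  {G : Finset σ → K}

theorem zero : FactorsAlong q δ (fun _ => (0 : K)) :=
  ⟨fun _ _ => ⟨0, 0, by simp⟩, by simp⟩

theorem const_mul (h : FactorsAlong q δ G) (c : K) : FactorsAlong q δ (fun U => c * G U) := by
  refine ⟨fun A hA => ?_, fun U hU => h.degree_le U (right_ne_zero_of_mul hU)⟩
  obtain ⟨P, Q, hPQ⟩ := h.split A hA
  exact ⟨fun U => c * P U, Q, fun U => by rw [hPQ, mul_assoc]⟩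

theorem map {L : Type*} [Field L] (h : FactorsAlong q δ G) (φ : K →+* L) :
    FactorsAlong q δ (fun U => φ (G U)) := by
  refine ⟨fun A hA => ?_, fun U hU => h.degree_le U fun h0 => hU (by simp [h0])⟩
  obtain ⟨P, Q, hPQ⟩ := h.split A hA
  exact ⟨fun U => φ (P U), fun U => φ (Q U), fun U => by rw [hPQ, map_mul]⟩

/-- The coefficients of the iterated partial derivative with respect to the variables in `R`. -/
theorem deriv (h : FactorsAlong q δ G) (R : Finset σ) :
    FactorsAlong q δ (fun U => if Disjoint U R then G (U ∪ R) else 0) := by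
  constructor
  · intro A hA
    obtain ⟨P, Q, hPQ⟩ := h.split A hA
    refine ⟨fun U => if Disjoint U (R ∩ A) then P (U ∪ R ∩ A) else 0,
      fun U => if Disjoint U (R \ A) then Q (U ∪ R \ A) else 0, fun U => ?_⟩
    have h1 : Disjoint U R ↔ Disjoint (U ∩ A) (R ∩ A) ∧ Disjoint (U \ A) (R \ A) := by
      simp only [Finset.disjoint_left, Finset.mem_inter, Finset.mem_sdiff]
      constructor
      · intro h
        exact ⟨fun r hr hr' => h hr.1 hr'.1, fun r hr hr' => h hr.1 hr'.1⟩
      · rintro ⟨h, h'⟩ r hr hr'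
        by_cases hrA : r ∈ A
        · exact h ⟨hr, hrA⟩ ⟨hr', hrA⟩
        · exact h' ⟨hr, hrA⟩ ⟨hr', hrA⟩
    simp only [h1, hPQ, Finset.union_inter_distrib_right, Finset.union_sdiff_distrib]
    split_ifs <;> simp_all
  · intro U hU a
    have hne : G (U ∪ R) ≠ 0 := fun h => hU (by simp [h])
    exact (Finset.card_le_card (Finset.filter_subset_filter _ Finset.subset_union_left)).trans
      (h.degree_le _ hne a)

/-- Truncation to degree at most `δ` in each part of another partition. -/
theorem truncate_split [Fintype σ] {q' : σ → κ} (h : FactorsAlong q δ G) (A : Finset σ)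
    (hA : ∀ r r', q r = q r' → r ∈ A → r' ∈ A) (hA' : ∀ r r', q' r = q' r' → r ∈ A → r' ∈ A) :
    ∃ P Q : Finset σ → K, ∀ U,
      (if ∀ r, (U.filter (q' · = q' r)).card ≤ δ then G U else 0) =
        P (U ∩ A) * Q (U \ A) := by
  obtain ⟨P, Q, hPQ⟩ := h.split A hA
  refine ⟨fun U => if ∀ r, (U.filter (q' · = q' r)).card ≤ δ then P U else 0,
      fun U => if ∀ r, (U.filter (q' · = q' r)).card ≤ δ then Q U else 0, fun U => ?_⟩
  have h1 : (∀ r, (U.filter (q' · = q' r)).card ≤ δ) ↔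
      (∀ r, ((U ∩ A).filter (q' · = q' r)).card ≤ δ) ∧
      (∀ r, ((U \ A).filter (q' · = q' r)).card ≤ δ) := by
    constructor
    · intro h
      exact ⟨fun r => (Finset.card_le_card
          (Finset.filter_subset_filter _ Finset.inter_subset_left)).trans (h r),
        fun r => (Finset.card_le_card
          (Finset.filter_subset_filter _ Finset.sdiff_subset)).trans (h r)⟩
    · rintro ⟨h2, h3⟩ r
      by_cases hr : r ∈ A
      · refine (Finset.card_le_card ?_).trans (h2 r)
        intro x hx
        simp only [Finset.mem_filter, Finset.mem_inter] at hx ⊢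
        exact ⟨⟨hx.1, hA' r x hx.2.symm hr⟩, hx.2⟩
      · refine (Finset.card_le_card ?_).trans (h3 r)
        intro x hx
        simp only [Finset.mem_filter, Finset.mem_sdiff] at hx ⊢
        exact ⟨⟨hx.1, fun hxA => hr (hA' x r hx.2 hxA)⟩, hx.2⟩
  simp only [h1, hPQ]
  split_ifs <;> simp_all

end FactorsAlong

/-- Derivatives commute with shifts; hence low-support coefficients of a derivative are coefficients
of the original at supports larger by `R`. -/
theorem shiftCoeff_deriv {σ K : Type*} [DecidableEq σ] [Fintype σ] [Field K] (w : σ → ℕ)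
    (f : Finset σ → Polynomial K) (R T : Finset σ) :
    shiftCoeff w Finset.univ (fun U => if Disjoint U R then f (U ∪ R) else 0) T =
      if Disjoint T R then shiftCoeff w Finset.univ f (T ∪ R) else 0 := by
  unfold shiftCoeff
  split_ifs with h
  · symm
    refine Finset.sum_subset_zero_on_sdiff ?_ ?_ ?_
    · exact Finset.powerset_mono.2 (Finset.sdiff_subset_sdiff le_rfl Finset.subset_union_left)
    · intro V hV
      simp only [Finset.mem_sdiff, Finset.mem_powerset] at hV
      simp only
      rw [if_neg, zero_mul]
      intro hd
      rw [Finset.disjoint_union_left] at hd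
      refine hV.2 fun r hr => ?_
      have h1 := hV.1 hr
      have h2 := Finset.disjoint_left.1 hd.2 hr
      simp only [Finset.mem_sdiff, Finset.mem_univ, true_and, Finset.mem_union] at h1 ⊢
      tauto
    · intro V hV
      rw [Finset.mem_powerset] at hV
      have hd : Disjoint V R := by
        rw [Finset.disjoint_left]
        intro r hr
        have := hV hr
        simp only [Finset.mem_sdiff, Finset.mem_univ, true_and, Finset.mem_union] at this
        tauto
      simp only
      rw [if_pos (Finset.disjoint_union_left.2 ⟨h, hd⟩), Finset.union_right_comm]
  · refine Finset.sum_eq_zero fun V _ => ?_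
    simp only
    rw [if_neg, zero_mul]
    exact fun hd => h (Finset.disjoint_union_left.1 hd).1

open Polynomial in
/-- Low-support concentration: a sum of fewer than `2 ^ m` multilinear gates along a chain of
coarser and coarser partitions vanishes, if all its derivatives of low order vanish at the point
`r ↦ X ^ w r`. -/
theorem sum_eq_zero_of_shiftCoeff_eq_zero {σ κ ι K : Type*} [DecidableEq σ] [Fintype σ]
    [DecidableEq κ] [Fintype ι] [Field K] (w : σ → ℕ) {δ m : ℕ}
    (hw : ∀ U V : Finset σ, U.card ≤ δ * m → V.card ≤ δ * m →
      ∑ r ∈ U, w r = ∑ r ∈ V, w r → U = V)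
    (hι : Fintype.card ι < 2 ^ m) (q : ℕ → σ → κ)
    (hq : ∀ i j, i ≤ j → ∀ r r', q i r = q i r' → q j r = q j r') (h a : ℕ) (lvl : ι → ℕ)
    (G : ι → Finset σ → K) (hlvl : ∀ i, a ≤ lvl i ∧ lvl i < a + 2 ^ h)
    (hG : ∀ i, FactorsAlong (q (lvl i)) δ (G i))
    (h0 : ∀ T : Finset σ, T.card ≤ δ * m + (δ + 1) * h →
      shiftCoeff w Finset.univ (fun U => C (∑ i, G i U)) T = 0) (U : Finset σ) :
    ∑ i, G i U = 0 := by
  induction h generalizing a lvl G U with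
  | zero =>
    have hl : ∀ i, lvl i = a := fun i => by
      have := hlvl i
      simp only [pow_zero] at this
      omega
    have := shiftCoeff_eq_zero_of_factorsAlong w hw hι (fun i => hl i ▸ hG i)
      (fun T hT => h0 T (by omega))
    have h1 := eq_zero_of_shiftCoeff_eq_zero w _ (B := Finset.univ) (R := ∅)
      (fun β _ => this _) U (Finset.subset_univ _)
    rw [Finset.empty_union] at h1
    exact C_eq_zero.1 h1
  | succ h ih =>
    set b := a + 2 ^ h with hb
    -- The elements of `R` share a part of `q b`, hence of every coarser partition, where these
    -- gates have degree at most `δ`.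
    have hkill : ∀ (R : Finset σ) (x : σ), R.card = δ + 1 → (∀ r ∈ R, q b r = q b x) →
        ∀ U, R ⊆ U → ∀ i, b ≤ lvl i → G i U = 0 := by
      intro R x hR hRx U hRU i hi
      by_contra hne
      have h1 := (hG i).degree_le U hne (q (lvl i) x)
      have h2 : R ⊆ U.filter (fun r => q (lvl i) r = q (lvl i) x) := fun r hr =>
        Finset.mem_filter.2 ⟨hRU hr, hq _ _ hi _ _ (hRx r hr)⟩
      have := Finset.card_le_card h2
      omega
    have hderiv : ∀ (R : Finset σ) (x : σ), R.card = δ + 1 → (∀ r ∈ R, q b r = q b x) →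
        ∀ U, R ⊆ U → ∑ i, G i U = 0 := by
      intro R x hR hRx U hRU
      have hsum : ∀ U, ∑ i, (if lvl i < b then
          (if Disjoint U R then G i (U ∪ R) else 0) else 0) =
          if Disjoint U R then ∑ i, G i (U ∪ R) else 0 := by
        intro U
        split_ifs with hd
        · refine Finset.sum_congr rfl fun i _ => ?_
          split_ifs with hi
          · rfl
          · exact (hkill R x hR hRx _ Finset.subset_union_right i (by omega)).symm
        · simp
      -- The killed gates stay as zero summands, so the index type and the bound on its size are
      -- unchanged; their level `a` is arbitrary.
      have h1 := ih a (fun i => if lvl i < b then lvl i else a)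
        (fun i U => if lvl i < b then (if Disjoint U R then G i (U ∪ R) else 0) else 0)
        ?_ ?_ ?_ (U \ R)
      · rw [hsum, if_pos Finset.sdiff_disjoint, Finset.sdiff_union_of_subset hRU] at h1
        exact h1
      · intro i
        have := hlvl i
        have : 0 < 2 ^ h := by positivity
        split_ifs <;> omega
      · intro i
        by_cases hi : lvl i < b
        · simp only [hi, if_true]
          exact (hG i).deriv R
        · simp only [hi, if_false]
          exact FactorsAlong.zero
      · intro T hT
        have h2 : (fun U => C (∑ i, (if lvl i < b then
            (if Disjoint U R then G i (U ∪ R) else 0) else 0))) =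
            fun U => if Disjoint U R then (fun U => C (∑ i, G i U)) (U ∪ R) else 0 := by
          funext U
          rw [hsum]
          split_ifs <;> simp
        rw [h2, shiftCoeff_deriv w (fun U => C (∑ i, G i U)) R T]
        split_ifs with hd
        · refine h0 _ ?_
          have := Finset.card_union_le T R
          rw [hR] at this
          rw [mul_add]
          omega
        · rfl
    have htrunc : ∀ U, ∑ i, (if ∀ r, (U.filter (q b · = q b r)).card ≤ δ then G i U else 0) =
        ∑ i, G i U := by
      intro U
      split_ifs with hU
      · rfl
      -- Some part of `q b` contains more than `δ` elements of `U`, so the coefficient at `U`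
      -- belongs to a vanishing derivative.
      · push Not at hU
        obtain ⟨x, hx⟩ := hU
        obtain ⟨R, hRs, hR⟩ := Finset.exists_subset_card_eq (Nat.succ_le_of_lt hx)
        rw [hderiv R x hR (fun r hr => (Finset.mem_filter.1 (hRs hr)).2) U
          (hRs.trans (Finset.filter_subset _ _))]
        simp
    rw [← htrunc]
    -- After truncation a gate finer than `q b` factors along `q b` with degree at most `δ`, so its
    -- level can be raised to `b`.
    refine ih b (fun i => max (lvl i) b)
      (fun i U => if ∀ r, (U.filter (q b · = q b r)).card ≤ δ then G i U else 0) ?_ ?_ ?_ U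
    · intro i
      have := hlvl i
      rw [pow_succ] at this
      have : 0 < 2 ^ h := by positivity
      exact ⟨le_max_right _ _, max_lt (by omega) (by omega)⟩
    · intro i
      constructor
      · intro A hA
        refine (hG i).truncate_split A (fun r r' h => hA r r' ?_) (fun r r' h => hA r r' ?_)
        · exact hq _ _ (le_max_left _ _) _ _ h
        · exact hq _ _ (le_max_right _ _) _ _ h
      · intro U hU c
        have hU1 : ∀ r, (U.filter (q b · = q b r)).card ≤ δ := by
          by_contra h
          exact hU (if_neg h)
        rw [if_pos hU1] at hU
        rcases le_total (lvl i) b with hle | hle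
        · rw [max_eq_right hle]
          rcases (U.filter (q b · = c)).eq_empty_or_nonempty with he | ⟨r, hr⟩
          · simp [he]
          · rw [← (Finset.mem_filter.1 hr).2]
            exact hU1 r
        · rw [max_eq_left hle]
          exact (hG i).degree_le U hU c
    · intro T hT
      have h2 : (fun U => C (∑ i, (if ∀ r, (U.filter (q b · = q b r)).card ≤ δ then
          G i U else 0))) = fun U => C (∑ i, G i U) := by
        funext U
        rw [htrunc]
      rw [h2]
      exact h0 T (hT.trans (by rw [mul_add]; omega))

/-! ### A small modulus that separates sparse binary numbers -/

theorem card_filter_card_le {σ : Type*} [Fintype σ] [DecidableEq σ] (D : ℕ) :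
    ((Finset.univ : Finset (Finset σ)).filter (fun U => U.card ≤ D)).card ≤
      (Fintype.card σ + 1) ^ D := by
  induction D with
  | zero =>
    rw [pow_zero, Finset.card_le_one]
    intro a ha b hb
    simp only [Finset.mem_filter, Finset.mem_univ, true_and, Nat.le_zero,
      Finset.card_eq_zero] at ha hb
    rw [ha, hb]
  | succ D ih =>
    have hsub : (Finset.univ : Finset (Finset σ)).filter (fun U => U.card ≤ D + 1) ⊆
        (((Finset.univ : Finset (Finset σ)).filter (fun U => U.card ≤ D)) ×ˢ
          (Finset.univ : Finset (Option σ))).image (fun p => p.1 ∪ p.2.toFinset) := by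
      intro U hU
      rw [Finset.mem_filter] at hU
      rw [Finset.mem_image]
      rcases U.eq_empty_or_nonempty with rfl | ⟨r, hr⟩
      · exact ⟨(∅, none), by simp, by simp⟩
      · refine ⟨(U.erase r, some r), ?_, ?_⟩
        · simp [Finset.card_erase_of_mem hr]
          omega
        · ext x
          by_cases h : x = r <;> simp [h, hr]
    refine (Finset.card_le_card hsub).trans (Finset.card_image_le.trans ?_)
    rw [Finset.card_product, pow_succ, Finset.card_univ, Fintype.card_option]
    exact Nat.mul_le_mul_right _ ih

theorem two_pow_lt_centralBinom {x : ℕ} (hx : 4 ≤ x) : 2 ^ x < x.centralBinom := by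
  have h1 := Nat.four_pow_lt_mul_centralBinom x hx
  have h2 : x < 2 ^ x := Nat.lt_two_pow_self
  have h3 : (4 : ℕ) ^ x = 2 ^ x * 2 ^ x := by
    rw [← mul_pow]
    norm_num
  by_contra h
  push Not at h
  have := Nat.mul_le_mul h2.le h
  omega

/-- The numbers up to `2 x` cannot all divide a member of a small family of small numbers. -/
theorem exists_not_dvd {ι : Type*} (s : Finset ι) (d : ι → ℕ) (n x : ℕ)
    (hd : ∀ i ∈ s, d i ≠ 0 ∧ d i ≤ 2 ^ n) (hx : n * s.card ≤ x) (hx4 : 4 ≤ x) :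
    ∃ p, 0 < p ∧ p ≤ 2 * x ∧ ∀ i ∈ s, ¬ p ∣ d i := by
  by_contra! hcon
  have hP : ∏ i ∈ s, d i ≠ 0 := Finset.prod_ne_zero_iff.2 fun i hi => (hd i hi).1
  have hle : ∏ i ∈ s, d i ≤ 2 ^ x := by
    calc ∏ i ∈ s, d i ≤ ∏ _i ∈ s, 2 ^ n := Finset.prod_le_prod' fun i hi => (hd i hi).2
      _ = 2 ^ (n * s.card) := by rw [Finset.prod_const, pow_mul]
      _ ≤ 2 ^ x := Nat.pow_le_pow_right (by norm_num) hx
  have hdvd : x.centralBinom ∣ ∏ i ∈ s, d i := by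
    rw [← Nat.factorization_prime_le_iff_dvd (Nat.centralBinom_ne_zero x) hP]
    intro p hp
    rw [← hp.pow_dvd_iff_le_factorization hP]
    -- Each prime power exactly dividing the central binomial coefficient is at most `2 * x`, hence
    -- divides some `d i`. Thus the coefficient, which exceeds `2 ^ x`, would divide a product that
    -- does not.
    obtain ⟨i, hi, h⟩ := hcon (p ^ x.centralBinom.factorization p) (pow_pos hp.pos _)
      (Nat.pow_factorization_choose_le (by omega))
    exact h.trans (Finset.dvd_prod_of_mem d hi)
  have := Nat.le_of_dvd (Nat.pos_of_ne_zero hP) hdvd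
  have := two_pow_lt_centralBinom hx4
  omega

/-- Modulo a suitable small `p`, the numbers with at most `D` binary digits `1` among the first
`n` digits are distinct. -/
theorem exists_separating_modulus (n D : ℕ) (hn : 1 ≤ n) (hD : 1 ≤ D) :
    ∃ p, 0 < p ∧ p ≤ (n + 1) ^ (2 * D + 2) ∧ ∀ U V : Finset (Fin n), U.card ≤ D → V.card ≤ D →
      (∑ r ∈ U, 2 ^ r.val) ≡ (∑ r ∈ V, 2 ^ r.val) [MOD p] → U = V := by
  classical
  let s : Finset (Finset (Fin n)) := Finset.univ.filter (fun U => U.card ≤ D)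
  have hs : s.card ≤ (n + 1) ^ D := by simpa using card_filter_card_le (σ := Fin n) D
  let e : Finset (Fin n) → ℕ := fun U => ∑ r ∈ U, 2 ^ r.val
  have he : ∀ U, e U = ∑ i ∈ U.map Fin.valEmbedding, 2 ^ i := fun U => by simp [e]
  have hinj : Function.Injective e := by
    intro U V h
    rw [he, he] at h
    exact Finset.map_injective _ (Finset.geomSum_injective le_rfl h)
  have hlt : ∀ U, e U < 2 ^ n := by
    intro U
    rw [he]
    refine Nat.geomSum_lt le_rfl ?_
    intro i hi
    obtain ⟨r, -, rfl⟩ := Finset.mem_map.1 hi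
    exact r.2
  -- The two truncated differences add up to the absolute difference. The bound is the number of
  -- bits times the number of pairs, plus `4` for the hypothesis `4 ≤ x`.
  obtain ⟨p, hp0, hp, hpd⟩ := exists_not_dvd (s.offDiag) (fun z => (e z.1 - e z.2) + (e z.2 - e z.1))
    n (n * ((n + 1) ^ D) ^ 2 + 4) (by
      rintro ⟨U, V⟩ hz
      rw [Finset.mem_offDiag] at hz
      have h1 : e U ≠ e V := fun h => hz.2.2 (hinj h)
      have h2 := hlt U
      have h3 := hlt V
      simp only
      omega) (by
      rw [Finset.offDiag_card]
      have : s.card * s.card ≤ ((n + 1) ^ D) ^ 2 := by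
        rw [sq]
        exact Nat.mul_le_mul hs hs
      have := Nat.mul_le_mul_left n ((Nat.sub_le (s.card * s.card) s.card).trans this)
      omega) (by omega)
  refine ⟨p, hp0, hp.trans ?_, ?_⟩
  · have h1 : (n + 1) ^ (2 * D + 2) = (n + 1) ^ 2 * ((n + 1) ^ D) ^ 2 := by ring
    have h2 : 2 ≤ (n + 1) ^ D :=
      (show 2 ≤ n + 1 by omega).trans (Nat.le_self_pow (by omega) _)
    rw [h1]
    nlinarith [Nat.mul_le_mul h2 h2, Nat.mul_le_mul hn hn]
  · intro U V hU hV h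
    by_contra hne
    refine hpd (U, V) (by simp [s, Finset.mem_offDiag, hU, hV, hne]) ?_
    rcases le_total (e U) (e V) with hle | hle
    · have := (Nat.modEq_iff_dvd' hle).1 h
      simpa [Nat.sub_eq_zero_of_le hle] using this
    · have := (Nat.modEq_iff_dvd' hle).1 h.symm
      simpa [Nat.sub_eq_zero_of_le hle] using this

/-! ### Coefficients of product gates -/

/-- The coefficients of the product of affine forms in disjoint sets of variables. -/
def listCoeff {F : Type*} [CommSemiring F] {n : ℕ} :
    List (AffineForm F n) → Finset (Fin n) → F
  | [], U => if U = ∅ then 1 else 0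
  | l :: L, U => l.const * listCoeff L U + ∑ r ∈ U, l.coeff r * listCoeff L (U.erase r)

section ListCoeff

variable {F : Type*} [Field F] {n : ℕ}

theorem listCoeff_cons_ne_zero {l : AffineForm F n} {L : List (AffineForm F n)}
    {U : Finset (Fin n)} (h : listCoeff (l :: L) U ≠ 0) :
    listCoeff L U ≠ 0 ∨ ∃ r ∈ U, l.coeff r ≠ 0 ∧ listCoeff L (U.erase r) ≠ 0 := by
  by_contra! hcon
  apply h
  rw [listCoeff, hcon.1, mul_zero, zero_add]
  refine Finset.sum_eq_zero fun r hr => ?_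
  by_cases hc : l.coeff r = 0
  · simp [hc]
  · simp [hcon.2 r hr hc]

theorem exists_mem_vars_of_listCoeff_ne_zero {L : List (AffineForm F n)} {U : Finset (Fin n)}
    (h : listCoeff L U ≠ 0) {r : Fin n} (hr : r ∈ U) : ∃ l ∈ L, r ∈ l.vars := by
  induction L generalizing U with
  | nil =>
    simp only [listCoeff, ne_eq, ite_eq_right_iff, one_ne_zero, imp_false, not_not] at h
    simp [h] at hr
  | cons l L ih =>
    rcases listCoeff_cons_ne_zero h with h | ⟨x, hx, hlx, h⟩
    · obtain ⟨l', hl', h'⟩ := ih h hr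
      exact ⟨l', by simp [hl'], h'⟩
    · by_cases hrx : r = x
      · exact ⟨l, by simp, hrx ▸ hlx⟩
      · obtain ⟨l', hl', h'⟩ := ih h (Finset.mem_erase.2 ⟨hrx, hr⟩)
        exact ⟨l', by simp [hl'], h'⟩

/-- Each factor contributes at most one variable to a monomial, so two variables in `Y` would come
from two different factors meeting `Y`. -/
theorem card_inter_le_one_of_listCoeff_ne_zero {L : List (AffineForm F n)} {Y : Finset (Fin n)}
    (hL : L.Pairwise fun l l' => ¬ ((l.vars ∩ (Y : Set (Fin n))).Nonempty ∧
      (l'.vars ∩ (Y : Set (Fin n))).Nonempty)) {U : Finset (Fin n)} (h : listCoeff L U ≠ 0) :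
    (U ∩ Y).card ≤ 1 := by
  induction L generalizing U with
  | nil =>
    simp only [listCoeff, ne_eq, ite_eq_right_iff, one_ne_zero, imp_false, not_not] at h
    simp [h]
  | cons l L ih =>
    rw [List.pairwise_cons] at hL
    rcases listCoeff_cons_ne_zero h with h | ⟨x, hx, hlx, h⟩
    · exact ih hL.2 h
    · by_cases hxY : x ∈ Y
      · rw [Finset.card_le_one]
        have key : ∀ y ∈ U ∩ Y, y = x := by
          intro y hy
          rw [Finset.mem_inter] at hy
          by_contra hne
          obtain ⟨l', hl', hy'⟩ :=
            exists_mem_vars_of_listCoeff_ne_zero h (Finset.mem_erase.2 ⟨hne, hy.1⟩)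
          exact hL.1 l' hl' ⟨⟨x, hlx, hxY⟩, ⟨y, hy', hy.2⟩⟩
        intro a ha b hb
        rw [key a ha, key b hb]
      · have h1 := ih hL.2 h
        rwa [Finset.erase_inter, Finset.erase_eq_of_notMem (by simp [hxY])] at h1

/-- Each factor lies entirely on one side of `A`, so it can be absorbed into `P` or into `Q`. -/
theorem listCoeff_split {L : List (AffineForm F n)} {A : Finset (Fin n)}
    (hL : ∀ l ∈ L, (∀ r, l.coeff r ≠ 0 → r ∈ A) ∨ (∀ r, l.coeff r ≠ 0 → r ∉ A)) :
    ∃ P Q : Finset (Fin n) → F, ∀ U, listCoeff L U = P (U ∩ A) * Q (U \ A) := by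
  induction L with
  | nil =>
    refine ⟨fun U => if U = ∅ then 1 else 0, fun U => if U = ∅ then 1 else 0, fun U => ?_⟩
    have h : U = ∅ ↔ U ∩ A = ∅ ∧ U \ A = ∅ := by
      constructor
      · rintro rfl
        simp
      · rintro ⟨h1, h2⟩
        rw [← Finset.sdiff_union_inter U A, h1, h2, Finset.union_empty]
    simp only [listCoeff, h]
    split_ifs <;> simp_all
  | cons l L ih =>
    obtain ⟨P, Q, hPQ⟩ := ih fun l' hl' => hL l' (by simp [hl'])
    rcases hL l (by simp) with hl | hl
    · refine ⟨fun W => l.const * P W + ∑ r ∈ W, l.coeff r * P (W.erase r), Q, fun U => ?_⟩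
      rw [listCoeff, hPQ, add_mul, mul_assoc, Finset.sum_mul]
      congr 1
      symm
      refine Finset.sum_subset_zero_on_sdiff Finset.inter_subset_left ?_ ?_
      · intro r hr
        have : l.coeff r = 0 := by
          by_contra h
          have := hl r h
          simp_all
        simp [this]
      · intro r hr
        rw [Finset.mem_inter] at hr
        rw [hPQ, Finset.erase_inter, mul_assoc, Finset.erase_sdiff_comm,
          Finset.erase_eq_of_notMem (s := U \ A) (by simp [hr.2])]
    · refine ⟨P, fun W => l.const * Q W + ∑ r ∈ W, l.coeff r * Q (W.erase r), fun U => ?_⟩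
      rw [listCoeff, hPQ, mul_add, Finset.mul_sum]
      congr 1
      · ring
      symm
      refine Finset.sum_subset_zero_on_sdiff Finset.sdiff_subset ?_ ?_
      · intro r hr
        have : l.coeff r = 0 := by
          by_contra h
          have := hl r h
          simp_all
        simp [this]
      · intro r hr
        rw [Finset.mem_sdiff] at hr
        rw [hPQ, Finset.erase_inter, Finset.erase_sdiff_comm,
          Finset.erase_eq_of_notMem (s := U ∩ A) (by simp [hr.2])]
        ring

theorem prod_map_toPoly_eq {L : List (AffineForm F n)}
    (hL : L.Pairwise fun l l' => Disjoint l.vars l'.vars) :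
    (L.map AffineForm.toPoly).prod =
      ∑ U, MvPolynomial.C (listCoeff L U) * ∏ r ∈ U, MvPolynomial.X r := by
  induction L with
  | nil =>
    rw [Finset.sum_eq_single ∅]
    · simp [listCoeff]
    · intro U _ hU
      simp [listCoeff, hU]
    · simp
  | cons l L ih =>
    rw [List.pairwise_cons] at hL
    -- No squares arise: a variable of `l` occurs in no monomial of the remaining factors.
    have key : ∀ (r : Fin n) (V : Finset (Fin n)), r ∈ V → l.coeff r * listCoeff L V = 0 := by
      intro r V hr
      by_contra h
      obtain ⟨l', hl', h'⟩ := exists_mem_vars_of_listCoeff_ne_zero (right_ne_zero_of_mul h) hr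
      exact Set.disjoint_left.1 (hL.1 l' hl') (left_ne_zero_of_mul h) h'
    rw [List.map_cons, List.prod_cons, ih hL.2, AffineForm.toPoly, add_mul]
    simp only [listCoeff, map_add, add_mul, Finset.sum_add_distrib, map_mul, mul_assoc]
    congr 1
    · rw [Finset.mul_sum]
    rw [Finset.sum_mul]
    simp only [map_sum, map_mul, Finset.sum_mul, Finset.mul_sum]
    have hin : ∀ U : Finset (Fin n), ∑ r ∈ U, MvPolynomial.C (l.coeff r) *
        MvPolynomial.C (listCoeff L (U.erase r)) * ∏ x ∈ U, MvPolynomial.X (R := F) x =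
        ∑ r, if r ∈ U then MvPolynomial.C (l.coeff r) *
        MvPolynomial.C (listCoeff L (U.erase r)) * ∏ x ∈ U, MvPolynomial.X x else 0 := by
      intro U
      rw [Finset.sum_ite_mem, Finset.univ_inter]
    simp only [hin]
    conv_rhs => rw [Finset.sum_comm]
    refine Finset.sum_congr rfl fun r _ => ?_
    have h1 : ∀ V : Finset (Fin n), MvPolynomial.C (l.coeff r) * MvPolynomial.X r *
        (MvPolynomial.C (listCoeff L V) * ∏ x ∈ V, MvPolynomial.X (R := F) x) =
        if r ∉ V then MvPolynomial.C (l.coeff r) * MvPolynomial.X r *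
        (MvPolynomial.C (listCoeff L V) * ∏ x ∈ V, MvPolynomial.X x) else 0 := by
      intro V
      split_ifs with hr
      · have := key r V hr
        rw [mul_mul_mul_comm, ← MvPolynomial.C_mul, this]
        simp
      · rfl
    rw [Finset.sum_congr rfl fun V _ => h1 V]
    rw [← Finset.sum_filter, ← Finset.sum_filter]
    refine Finset.sum_nbij' (fun V => insert r V) (fun U => U.erase r) ?_ ?_ ?_ ?_ ?_
    · intro V _
      simp
    · intro U _
      simp
    · intro V hV
      exact Finset.erase_insert (Finset.mem_filter.1 hV).2
    · intro U hU
      exact Finset.insert_erase (Finset.mem_filter.1 hU).2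
    · intro V hV
      have hr := (Finset.mem_filter.1 hV).2
      rw [Finset.erase_insert hr, Finset.prod_insert hr]
      ring

end ListCoeff

/-! ### Joins of partitions and the distance condition -/

/-- The label of a variable in the finest common coarsening of the partitions `P j`, `j ≤ i`. -/
def joinLabel {n k : ℕ} (P : Fin k → Finpartition (Finset.univ : Finset (Fin n))) (i : ℕ)
    (r : Fin n) : Set (Finset (Fin n)) :=
  {Z | (∀ j : Fin k, j.val ≤ i → ∃ W ⊆ (P j).parts, W.sup id = Z) ∧ r ∈ Z}

/-- Raising the index only discards sets `Z`, by a condition that does not involve the variable. -/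
theorem joinLabel_mono {n k : ℕ} (P : Fin k → Finpartition (Finset.univ : Finset (Fin n)))
    (i j : ℕ) (hij : i ≤ j) (r r' : Fin n) (h : joinLabel P i r = joinLabel P i r') :
    joinLabel P j r = joinLabel P j r' := by
  ext Z
  have hZ := Set.ext_iff.1 h Z
  simp only [joinLabel, Set.mem_ofPred_eq] at hZ ⊢
  constructor
  · rintro ⟨h1, h2⟩
    exact ⟨h1, (hZ.1 ⟨fun l hl => h1 l (hl.trans hij), h2⟩).2⟩
  · rintro ⟨h1, h2⟩
    exact ⟨h1, (hZ.2 ⟨fun l hl => h1 l (hl.trans hij), h2⟩).2⟩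

theorem joinLabel_eq_of_mem_part {n k : ℕ}
    (P : Fin k → Finpartition (Finset.univ : Finset (Fin n))) (i : Fin k) {Y : Finset (Fin n)}
    (hY : Y ∈ (P i).parts) {r r' : Fin n} (hr : r ∈ Y) (hr' : r' ∈ Y) :
    joinLabel P i r = joinLabel P i r' := by
  have key : ∀ r r', r ∈ Y → r' ∈ Y → ∀ Z, (∃ W ⊆ (P i).parts, W.sup id = Z) → r ∈ Z → r' ∈ Z := by
    rintro r r' hr hr' Z ⟨W, hW, rfl⟩ h
    rw [Finset.mem_sup] at h ⊢
    obtain ⟨Y', hY', h⟩ := h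
    have : Y' = Y := (P i).eq_of_mem_parts (hW hY') hY h hr
    exact ⟨Y', hY', this ▸ hr'⟩
  ext Z
  exact ⟨fun h => ⟨h.1, key r r' hr hr' Z (h.1 i le_rfl) h.2⟩,
    fun h => ⟨h.1, key r' r hr' hr Z (h.1 i le_rfl) h.2⟩⟩

open Classical in
-- Colors of `P i` lie inside parts of the join, which gives the factorization. Conversely a part of
-- the join is covered by at most `δ` colors, each containing at most one variable of a given
-- monomial.
theorem factorsAlong_listCoeff {F : Type*} [Field F] {n k δ : ℕ} (hδ : 1 ≤ δ)
    {P : Fin k → Finpartition (Finset.univ : Finset (Fin n))} (hP : PartitionDistanceLE P δ)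
    (i : Fin k) {L : List (AffineForm F n)} (hL : InducesPartition L (P i)) :
    FactorsAlong (joinLabel P i) δ (listCoeff L) := by
  constructor
  · intro A hA
    refine listCoeff_split fun l hl => ?_
    by_cases hne : ∃ r ∈ l.vars, r ∈ A
    · obtain ⟨r, hr, hrA⟩ := hne
      obtain ⟨Y, hY, hlY⟩ := hL.1 l hl ⟨r, hr⟩
      exact Or.inl fun r' hr' => hA r r' (joinLabel_eq_of_mem_part P i hY (hlY hr) (hlY hr')) hrA
    · push Not at hne
      exact Or.inr fun r hr => hne r hr
  · intro U hU a
    rcases (U.filter (joinLabel P i · = a)).eq_empty_or_nonempty with he | ⟨r, hr⟩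
    · simp [he]
    rw [Finset.mem_filter] at hr
    obtain ⟨Y, hY, hrY⟩ := (P i).exists_mem (Finset.mem_univ r)
    obtain ⟨N, hN, hYN, hNδ, hZ⟩ : ∃ N ⊆ (P i).parts, Y ∈ N ∧ N.card ≤ δ ∧
        ∀ j < i, ∃ Z ⊆ (P j).parts, Z.sup id = N.sup id := by
      -- The distance condition says nothing about the first partition, but there the color alone
      -- will do.
      rcases Nat.eq_zero_or_pos i.val with h0 | h0
      · refine ⟨{Y}, by simpa using hY, by simp, by simpa using hδ, fun j hj => ?_⟩
        have : j.val < i.val := hj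
        omega
      · exact hP i h0 Y hY
    -- The union of `N` is saturated for all partitions up to `i`, so it contains every variable
    -- with the label of `r`.
    have hmem : N.sup id ∈ joinLabel P i r := by
      refine ⟨fun j hj => ?_, Finset.mem_sup.2 ⟨Y, hYN, hrY⟩⟩
      rcases Nat.lt_or_eq_of_le hj with h | h
      · exact hZ j h
      · exact ⟨N, Fin.ext h ▸ hN, rfl⟩
    have hsub : U.filter (joinLabel P i · = a) ⊆ N.biUnion (fun Y => U ∩ Y) := by
      intro x hx
      rw [Finset.mem_filter] at hx
      have h1 : N.sup id ∈ joinLabel P i x := by rwa [hx.2, ← hr.2]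
      obtain ⟨Y', hY', h2⟩ := Finset.mem_sup.1 h1.2
      exact Finset.mem_biUnion.2 ⟨Y', hY', Finset.mem_inter.2 ⟨hx.1, h2⟩⟩
    calc _ ≤ _ := Finset.card_le_card hsub
      _ ≤ N.card * 1 := Finset.card_biUnion_le_card_mul _ _ _ fun Y' hY' =>
        card_inter_le_one_of_listCoeff_ne_zero (hL.2.imp fun h => h Y' (hN hY')) hU
      _ ≤ δ := by omega

theorem pairwise_disjoint_vars_of_inducesPartition {F : Type*} [Field F] {n : ℕ}
    {L : List (AffineForm F n)} {P : Finpartition (Finset.univ : Finset (Fin n))}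
    (hL : InducesPartition L P) : L.Pairwise fun l l' => Disjoint l.vars l'.vars := by
  refine hL.2.imp fun {l l'} h => Set.disjoint_left.2 fun r hr hr' => ?_
  obtain ⟨Y, hY, hrY⟩ := P.exists_mem (Finset.mem_univ r)
  exact h Y hY ⟨⟨r, hr, hrY⟩, ⟨r, hr', hrY⟩⟩

open Classical in
theorem DepthThreeCircuit.exists_factorsAlong {F : Type*} [Field F] {n k δ : ℕ} (hδ : 1 ≤ δ)
    (D : DepthThreeCircuit F n k) (hD : D.HasDistance δ) :
    ∃ (q : ℕ → Fin n → Set (Finset (Fin n))) (G : Fin k → Finset (Fin n) → F),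
      (∀ i j, i ≤ j → ∀ r r', q i r = q i r' → q j r = q j r') ∧
      (∀ i : Fin k, FactorsAlong (q i) δ (G i)) ∧
      D.toPoly = ∑ U, MvPolynomial.C (∑ i, G i U) * ∏ r ∈ U, MvPolynomial.X r := by
  obtain ⟨σ, P, hind, hdist⟩ := hD
  refine ⟨joinLabel P, fun i U => D.weight (σ i) * listCoeff (D.factors (σ i)) U,
    joinLabel_mono P, fun i => (factorsAlong_listCoeff hδ hdist i (hind i)).const_mul _, ?_⟩
  rw [DepthThreeCircuit.toPoly, ← Equiv.sum_comp σ]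
  simp only [map_sum, Finset.sum_mul]
  rw [Finset.sum_comm]
  refine Finset.sum_congr rfl fun i _ => ?_
  rw [DepthThreeCircuit.gatePoly,
    prod_map_toPoly_eq (pairwise_disjoint_vars_of_inducesPartition (hind i)), Finset.mul_sum]
  refine Finset.sum_congr rfl fun U _ => ?_
  rw [map_mul, mul_assoc]

/-! ### Bounding the running time of loops -/

/-- The program `p`, started in the state `s`, halts within `B` steps in a state with the
property `Q`. -/
def Halts {K : Type v} [Field K] (α : ℕ → K) (p : RamProg) (s : RamState K) (B : ℕ)
    (Q : RamState K → Prop) : Prop :=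
  ∃ t s', t ≤ B ∧ RamExec α p s t s' ∧ Q s'

section Halts

variable {K : Type v} [Field K] {α : ℕ → K} {p p' : RamProg} {s : RamState K} {B B' : ℕ}
  {Q R : RamState K → Prop}

theorem Halts.mono (h : Halts α p s B Q) (hB : B ≤ B') (hQ : ∀ s', Q s' → R s') :
    Halts α p s B' R := by
  obtain ⟨t, s', ht, he, hs⟩ := h
  exact ⟨t, s', ht.trans hB, he, hQ _ hs⟩

theorem Halts.seq (h : Halts α p s B Q) (h' : ∀ s', Q s' → Halts α p' s' B' R) :
    Halts α (.seq p p') s (B + B') R := by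
  obtain ⟨t, s', ht, he, hs⟩ := h
  obtain ⟨t', s'', ht', he', hs'⟩ := h' s' hs
  exact ⟨t + t', s'', Nat.add_le_add ht ht', .seq he he', hs'⟩

theorem RamExec.halts {t : ℕ} {s' : RamState K} (h : RamExec α p s t s') (hQ : Q s') :
    Halts α p s t Q :=
  ⟨t, s', le_rfl, h, hQ⟩

theorem RamExec.halts_seq {t : ℕ} {s' : RamState K} (h : RamExec α p s t s')
    (h' : Halts α p' s' B' Q) : Halts α (.seq p p') s (B' + t) Q := by
  rw [add_comm]
  exact (h.halts (Q := (· = s')) rfl).seq fun _ hs => hs ▸ h'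

theorem halts_whileNonzero {r : ℕ} (Inv : ℕ → RamState K → Prop) (J : ℕ)
    (hstep : ∀ j < J, ∀ s, Inv j s → s.N r ≠ 0 ∧ Halts α p s B (Inv (j + 1)))
    (hend : ∀ s, Inv J s → s.N r = 0) (h0 : Inv 0 s) :
    Halts α (.whileNonzero r p) s (J * (B + 1) + 1) (Inv J) := by
  induction J generalizing Inv s with
  | zero => exact (RamExec.whileNonzero_zero (hend s h0)).halts h0 |>.mono (by omega) fun _ => id
  | succ J ih =>
    obtain ⟨hr, t, s', ht, he, hs⟩ := hstep 0 (by omega) s h0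
    obtain ⟨t', s'', ht', he', hs'⟩ := ih (fun j => Inv (j + 1))
      (fun j hj => hstep (j + 1) (by omega)) hend hs
    refine ⟨t + t' + 1, s'', ?_, .whileNonzero_pos hr he he', hs'⟩
    rw [Nat.succ_mul]
    omega

end Halts

/-- The registers `N[i]`, `i < m`, and `A[i]`, `i < q`, have the same contents in both states. -/
structure RamState.Keeps {K : Type v} (m q : ℕ) (s s' : RamState K) : Prop where
  nat : ∀ i < m, s'.N i = s.N i
  field : ∀ i < q, s'.A i = s.A i

theorem RamState.Keeps.trans {K : Type v} {m q m' q' m'' q'' : ℕ} {s s' s'' : RamState K}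
    (h : s.Keeps m q s') (h' : s'.Keeps m' q' s'') (hm : m'' ≤ m) (hm' : m'' ≤ m')
    (hq : q'' ≤ q) (hq' : q'' ≤ q') : s.Keeps m'' q'' s'' :=
  ⟨fun i hi => by rw [h'.nat i (by omega), h.nat i (by omega)],
    fun i hi => by rw [h'.field i (by omega), h.field i (by omega)]⟩

/-- Between the two states a list of points that contains the set `S` has been output. -/
def RamState.Emits {K : Type v} {n : ℕ} (S : Set (Fin n → K)) (s s' : RamState K) : Prop :=
  ∃ H : List (Fin n → K), s'.out = s.out ++ (H.map List.ofFn).flatten ∧ ∀ x ∈ S, x ∈ H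

theorem RamState.Emits.trans {K : Type v} {n : ℕ} {S S' S'' : Set (Fin n → K)}
    {s s' s'' : RamState K} (h : s.Emits S s') (h' : s'.Emits S' s'') (hS : S'' ⊆ S ∪ S') :
    s.Emits S'' s'' := by
  obtain ⟨H, hH, hm⟩ := h
  obtain ⟨H', hH', hm'⟩ := h'
  refine ⟨H ++ H', by simp [hH, hH'], fun x hx => ?_⟩
  rcases hS hx with h | h
  · simp [hm x h]
  · simp [hm' x h]

/-- The counter is decremented before the body runs, so the body sees the values from `G - 1` down
to `0`. It may use the registers above `r` freely. -/
theorem halts_countdown {K : Type v} [Field K] {α : ℕ → K} {n r q B G : ℕ} {body : RamProg}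
    (S : ℕ → Set (Fin n → K)) (s₀ : RamState K) (hr : 3 < r) (h3 : s₀.N 3 = 1) (hG : s₀.N r = G)
    (hbody : ∀ i < G, ∀ s, s₀.Keeps r q s → s.N r = i →
      Halts α body s B (fun s' => s.Keeps (r + 1) q s' ∧ s.Emits (S i) s')) :
    Halts α (.whileNonzero r (.seq (.sub r r 3) body)) s₀ (G * (B + 2) + 1)
      (fun s' => s₀.Keeps r q s' ∧ s₀.Emits {x | ∃ i < G, x ∈ S i} s') := by
  refine (halts_whileNonzero (B := B + 1) (fun j s => s₀.Keeps r q s ∧ s.N r = G - j ∧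
    s₀.Emits {x | ∃ i, G - j ≤ i ∧ i < G ∧ x ∈ S i} s) G ?_ ?_ ?_).mono le_rfl ?_
  · rintro j hj s ⟨hk, hN, he⟩
    refine ⟨by omega, RamExec.halts_seq (.sub r r 3 s) ?_⟩
    have hk' : s.Keeps r q { s with N := Function.update s.N r (s.N r - s.N 3) } :=
      ⟨fun i hi => Function.update_of_ne (by omega) _ _, fun _ _ => rfl⟩
    refine (hbody (G - (j + 1)) (by omega) _ (hk.trans hk' le_rfl le_rfl le_rfl le_rfl) ?_).mono
      le_rfl ?_
    · have := hk.nat 3 hr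
      simp only [Function.update_self]
      omega
    · rintro s' ⟨hk1, he1⟩
      refine ⟨(hk.trans hk' le_rfl le_rfl le_rfl le_rfl).trans hk1 le_rfl (by omega) le_rfl le_rfl,
        ?_, he.trans (s' := { s with N := _ }) he1 ?_⟩
      · have := hk.nat 3 hr
        rw [hk1.nat r (by omega)]
        simp only [Function.update_self]
        omega
      · rintro x ⟨i, hi, hiG, hx⟩
        by_cases h : i = G - (j + 1)
        · exact Or.inr (h ▸ hx)
        · exact Or.inl ⟨i, by omega, hiG, hx⟩
  · rintro s ⟨-, hN, -⟩
    omega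
  · exact ⟨⟨fun _ _ => rfl, fun _ _ => rfl⟩, by omega, [], by simp,
      by rintro x ⟨i, h1, h2, -⟩; omega⟩
  · rintro s ⟨hk, -, H, hH, hm⟩
    exact ⟨hk, H, hH, fun x ⟨i, hi, hx⟩ => hm x ⟨i, by omega, hi, hx⟩⟩

/-! ### The weights, the points and the program -/

/-- `2 ^ r` modulo `m + 1`, computed by doubling and reducing; the representative is between `0`
and `m + 1`. -/
def modPow (m : ℕ) : ℕ → ℕ
  | 0 => 1
  | r + 1 => if 2 * modPow m r - m = 0 then 2 * modPow m r else 2 * modPow m r - m - 1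

theorem modPow_le (m r : ℕ) : modPow m r ≤ m + 1 := by
  induction r with
  | zero => simp [modPow]
  | succ r ih =>
    rw [modPow]
    split_ifs <;> omega

theorem modPow_modEq (m r : ℕ) : modPow m r ≡ 2 ^ r [MOD m + 1] := by
  induction r with
  | zero => rfl
  | succ r ih =>
    rw [modPow, pow_succ, mul_comm (2 ^ r) 2]
    refine Nat.ModEq.trans ?_ (ih.mul_left 2)
    split_ifs with h
    · rfl
    · have h1 : 2 * modPow m r = 2 * modPow m r - m - 1 + (m + 1) := by omega
      conv_rhs => rw [h1]
      simp [Nat.ModEq]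

/-- The point `(a ^ w r + b * c ^ w r)_r` for the weights `w r = 2 ^ r mod (m + 1)`. -/
def curvePoint {K : Type v} [Field K] (n m : ℕ) (a b c : K) : Fin n → K :=
  fun r => a ^ modPow m r + b * c ^ modPow m r

namespace RamProg

/-- `A[3] := A[3] * A[0] ^ N[12]`, `A[4] := A[4] * A[2] ^ N[12]` -/
def powers : RamProg :=
  .whileNonzero 12 (.seq (.sub 12 12 3) (.seq (.fmul 3 3 0) (.fmul 4 4 2)))

/-- Output `A[0] ^ N[10] + A[1] * A[2] ^ N[10]` and double `N[10]` modulo `N[6] + 1`. -/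
def coordinate : RamProg :=
  .seq (.add 12 10 4) (.seq (.fone 3) (.seq (.fone 4) (.seq powers
    (.seq (.fmul 5 1 4) (.seq (.fadd 5 3 5) (.seq (.emit 5)
      -- The value in `N[13]` is zero exactly if the doubled weight is at most `N[6]`; then nothing
      -- needs reduction, and `.const 13 0` serves as an idle instruction.
      (.seq (.add 10 10 10) (.seq (.sub 13 10 6) (.ifZero 13 (.const 13 0) (.sub 10 13 3))))))))))

/-- The register `N[10]` carries the current weight, starting from `2 ^ 0`. Register `N[4]` is never
written, so adding it copies a value. -/
def point : RamProg :=
  .seq (.const 10 1) (.seq (.add 11 0 4) (.whileNonzero 11 (.seq (.sub 11 11 3) coordinate)))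

/-- The counter `N[6]` is itself the parameter `m` of `modPow`; the other three counters index `a`,
`b`, `c` and start from the bound in `N[5]`. -/
def allPoints : RamProg :=
  .whileNonzero 6 (.seq (.sub 6 6 3) (.seq (.add 7 5 4)
    (.whileNonzero 7 (.seq (.sub 7 7 3) (.seq (.felem 0 7) (.seq (.add 8 5 4)
      (.whileNonzero 8 (.seq (.sub 8 8 3) (.seq (.felem 1 8) (.seq (.add 9 5 4)
        (.whileNonzero 9 (.seq (.sub 9 9 3) (.seq (.felem 2 9) point)))))))))))))

/-- `N[r] := N[r] + N[12] * N[x]` -/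
def addMul (r x : ℕ) : RamProg :=
  .whileNonzero 12 (.seq (.sub 12 12 3) (.add r r x))

/-- `N[6] := N[6] * (N[0] + 1) ^ N[10]` -/
def mulPow : RamProg :=
  .whileNonzero 10 (.seq (.sub 10 10 3) (.seq (.add 11 6 4) (.seq (.add 12 0 4) (addMul 6 11))))

/-- Multiply `N[6]` by `(N[0] + 1) ^ N[8]` and double `N[7]`, until `N[7]` is at least `N[13]`. -/
def modulusLoop : RamProg :=
  .whileNonzero 9 (.seq (.add 10 8 4) (.seq mulPow (.seq (.add 7 7 7) (.sub 9 13 7))))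

/-- Three doublings produce `8 * δ` in `N[8]`. At the end `N[6]` bounds the moduli, and `N[5]` is `n
+ 1` times as large, which exceeds all degrees that occur. -/
def bounds : RamProg :=
  .seq (.const 3 1) (.seq (.add 8 2 2) (.seq (.add 8 8 8) (.seq (.add 8 8 8) (.seq (.const 7 1)
    (.seq (.add 13 1 3) (.seq (.const 6 1) (.seq (.sub 9 13 7) (.seq modulusLoop
      (.seq (.add 5 6 4) (.seq (.add 12 0 4) (addMul 5 6)))))))))))

def hittingSet : RamProg := .seq bounds allPoints

end RamProg

/-- The registers that the loops over the points read. -/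
structure RamState.Params {K : Type v} (s : RamState K) (n G m : ℕ) : Prop where
  n : s.N 0 = n
  one : s.N 3 = 1
  zero : s.N 4 = 0
  bound : s.N 5 = G
  modulus : s.N 6 = m

theorem RamState.Params.of_keeps {K : Type v} {s s' : RamState K} {n G m r q : ℕ} (h : s.Params n G m)
    (hk : s.Keeps r q s') (hr : 7 ≤ r) : s'.Params n G m :=
  ⟨(hk.nat 0 (by omega)).trans h.n, (hk.nat 3 (by omega)).trans h.one,
    (hk.nat 4 (by omega)).trans h.zero, (hk.nat 5 (by omega)).trans h.bound,
    (hk.nat 6 (by omega)).trans h.modulus⟩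

theorem RamState.keeps_update_field {K : Type v} (s : RamState K) (m r : ℕ) (x : K) :
    s.Keeps m r { s with A := Function.update s.A r x } :=
  ⟨fun _ _ => rfl, fun _ hi => Function.update_of_ne (by omega) _ _⟩

theorem RamState.keeps_update_nat {K : Type v} (s : RamState K) (r q x : ℕ) :
    s.Keeps r q { s with N := Function.update s.N r x } :=
  ⟨fun _ hi => Function.update_of_ne (by omega) _ _, fun _ _ => rfl⟩

/-! ### Output and running time of the program -/

section Programs

variable {K : Type v} [Field K] {α : ℕ → K}

theorem halts_powers (s₀ : RamState K) (h3 : s₀.N 3 = 1) :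
    Halts α .powers s₀ (s₀.N 12 * 4 + 1) (fun s' => s₀.Keeps 12 3 s' ∧ s'.out = s₀.out ∧
      s'.A 3 = s₀.A 3 * s₀.A 0 ^ s₀.N 12 ∧ s'.A 4 = s₀.A 4 * s₀.A 2 ^ s₀.N 12) := by
  refine (halts_whileNonzero (B := 3) (fun j s => s₀.Keeps 12 3 s ∧ s.out = s₀.out ∧
    s.A 3 = s₀.A 3 * s₀.A 0 ^ j ∧ s.A 4 = s₀.A 4 * s₀.A 2 ^ j ∧ s.N 12 = s₀.N 12 - j)
    (s₀.N 12) ?_ ?_ ?_).mono le_rfl ?_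
  · rintro j hj s ⟨hk, ho, ha, hc, hN⟩
    refine ⟨by omega, RamExec.halts_seq (.sub ..) (RamExec.halts_seq (.fmul ..)
      (RamExec.halts (.fmul ..) ⟨⟨?_, ?_⟩, ho, ?_, ?_, ?_⟩))⟩
    · intro i hi
      rw [← hk.nat i hi]
      exact Function.update_of_ne (by omega) _ _
    · intro i hi
      rw [← hk.field i hi]
      simp only
      rw [Function.update_of_ne (by omega), Function.update_of_ne (by omega)]
    · have := hk.field 0 (by norm_num)
      simp [ha, this, pow_succ, mul_assoc]
    · have := hk.field 2 (by norm_num)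
      simp [hc, this, pow_succ, mul_assoc]
    · have := hk.nat 3 (by norm_num)
      simp only [Function.update_self]
      omega
  · rintro s ⟨-, -, -, -, hN⟩
    omega
  · exact ⟨⟨fun _ _ => rfl, fun _ _ => rfl⟩, rfl, by simp, by simp, by omega⟩
  · rintro s ⟨hk, ho, ha, hc, -⟩
    exact ⟨hk, ho, ha, hc⟩

theorem halts_coordinate (s : RamState K) (h3 : s.N 3 = 1) (h4 : s.N 4 = 0) :
    Halts α .coordinate s (s.N 10 * 4 + 11) (fun s' => s.Keeps 10 3 s' ∧ s'.N 11 = s.N 11 ∧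
      s'.N 10 = (if 2 * s.N 10 - s.N 6 = 0 then 2 * s.N 10 else 2 * s.N 10 - s.N 6 - 1) ∧
      s'.out = s.out ++ [s.A 0 ^ s.N 10 + s.A 1 * s.A 2 ^ s.N 10]) := by
  let s₁ : RamState K := { s with
    N := Function.update s.N 12 (s.N 10 + s.N 4)
    A := Function.update (Function.update s.A 3 1) 4 1 }
  have hN : s₁.N 12 = s.N 10 := by simp [s₁, h4]
  obtain ⟨t, s₂, ht, he, hk, ho, ha, hc⟩ := halts_powers (α := α) s₁ (by simp [s₁, h3])
  rw [hN] at ht ha hc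
  have hk' : s.Keeps 12 3 s₂ := by
    refine ⟨fun i hi => ?_, fun i hi => ?_⟩
    · rw [hk.nat i hi]
      exact Function.update_of_ne (by omega) _ _
    · rw [hk.field i hi]
      simp only [s₁]
      rw [Function.update_of_ne (by omega), Function.update_of_ne (by omega)]
  have ha' : s₂.A 3 = s.A 0 ^ s.N 10 := by simp [ha, s₁]
  have hc' : s₂.A 4 = s.A 2 ^ s.N 10 := by simp [hc, s₁]
  have h0 := hk'.field 0 (by norm_num)
  have h1 := hk'.field 1 (by norm_num)
  have h2 := hk'.field 2 (by norm_num)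
  have hN3 := hk'.nat 3 (by norm_num)
  have hN6 := hk'.nat 6 (by norm_num)
  have hN10 := hk'.nat 10 (by norm_num)
  have hN11 := hk'.nat 11 (by norm_num)
  have ho' : s₂.out = s.out := ho
  let s₃ : RamState K :=
    { N := Function.update (Function.update s₂.N 10 (s₂.N 10 + s₂.N 10)) 13
        (s₂.N 10 + s₂.N 10 - s₂.N 6)
      A := Function.update (Function.update s₂.A 5 (s₂.A 1 * s₂.A 4)) 5
        (s₂.A 3 + s₂.A 1 * s₂.A 4)
      out := s₂.out ++ [s₂.A 3 + s₂.A 1 * s₂.A 4] }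
  have hrun : Halts α (.ifZero 13 (.const 13 0) (.sub 10 13 3)) s₃ 2 (fun s' =>
      s.Keeps 10 3 s' ∧ s'.N 11 = s.N 11 ∧
      s'.N 10 = (if 2 * s.N 10 - s.N 6 = 0 then 2 * s.N 10 else 2 * s.N 10 - s.N 6 - 1) ∧
      s'.out = s.out ++ [s.A 0 ^ s.N 10 + s.A 1 * s.A 2 ^ s.N 10]) := by
    have hA : ∀ i < 3, s₃.A i = s.A i := by
      intro i hi
      rw [← hk'.field i hi]
      simp only [s₃]
      rw [Function.update_of_ne (by omega), Function.update_of_ne (by omega)]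
    have hN : ∀ i < 10, s₃.N i = s.N i := by
      intro i hi
      rw [← hk'.nat i (by omega)]
      simp only [s₃]
      rw [Function.update_of_ne (by omega), Function.update_of_ne (by omega)]
    have h13 : s₃.N 13 = 2 * s.N 10 - s.N 6 := by
      simp only [s₃, Function.update_self, hN10, hN6]
      omega
    have hout : s₃.out = s.out ++ [s.A 0 ^ s.N 10 + s.A 1 * s.A 2 ^ s.N 10] := by
      simp only [s₃, ha', hc', ho', h1]
    by_cases hz : s₃.N 13 = 0
    · refine ⟨1 + 1, _, le_rfl, .ifZero_zero hz (.const ..), ⟨fun i hi => ?_, hA⟩, ?_, ?_, hout⟩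
      · rw [← hN i hi]
        exact Function.update_of_ne (by omega) _ _
      · simpa [s₃] using hN11
      · rw [h13] at hz
        rw [if_pos hz]
        simp [s₃, hN10, two_mul]
    · refine ⟨1 + 1, _, le_rfl, .ifZero_pos hz (.sub ..), ⟨fun i hi => ?_, hA⟩, ?_, ?_, hout⟩
      · rw [← hN i hi]
        exact Function.update_of_ne (by omega) _ _
      · simpa [s₃] using hN11
      · have h3' : s₃.N 3 = 1 := by rw [hN 3 (by norm_num), h3]
        rw [← h13, if_neg hz]
        simp [h3']
  obtain ⟨t', s', ht', he', hQ⟩ := hrun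
  have h5 : Function.update (Function.update s₂.A 5 (s₂.A 1 * s₂.A 4)) 5
      (Function.update s₂.A 5 (s₂.A 1 * s₂.A 4) 3 +
        Function.update s₂.A 5 (s₂.A 1 * s₂.A 4) 5) = s₃.A := by
    simp [s₃]
  refine ⟨1 + (1 + (1 + (t + (1 + (1 + (1 + (1 + (1 + t')))))))), s', by omega,
    .seq (.add ..) (.seq (.fone ..) (.seq (.fone ..) (.seq he (.seq (.fmul ..) (.seq (.fadd ..)
      (.seq (.emit ..) (.seq (.add ..) (.seq (.sub ..) ?_)))))))), hQ⟩
  convert he' using 1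
  simp [s₃]

theorem halts_point {n m : ℕ} (s₀ : RamState K) (h0 : s₀.N 0 = n) (h3 : s₀.N 3 = 1)
    (h4 : s₀.N 4 = 0) (h6 : s₀.N 6 = m) :
    Halts α .point s₀ (n * (4 * m + 17) + 3) (fun s' => s₀.Keeps 10 3 s' ∧
      s₀.Emits {curvePoint n m (s₀.A 0) (s₀.A 1) (s₀.A 2)} s') := by
  set a := s₀.A 0
  set b := s₀.A 1
  set c := s₀.A 2
  refine Halts.mono (B := n * (4 * m + 17) + 1 + 1 + 1)
    (RamExec.halts_seq (.const ..) (RamExec.halts_seq (.add ..)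
      (halts_whileNonzero (B := 4 * m + 16) (fun j s => s₀.Keeps 10 3 s ∧ s.N 11 = n - j ∧
        s.N 10 = modPow m j ∧ s.out = s₀.out ++ (List.range j).map
          (fun r => a ^ modPow m r + b * c ^ modPow m r)) n ?_ ?_ ?_))) (by omega) ?_
  · rintro j hj s ⟨hk, hN, hw, ho⟩
    have hs3 := hk.nat 3 (by norm_num)
    have hs4 := hk.nat 4 (by norm_num)
    have hs6 := hk.nat 6 (by norm_num)
    refine ⟨by omega, (RamExec.halts_seq (.sub ..) (halts_coordinate _ ?_ ?_)).mono ?_ ?_⟩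
    · simp [hs3, h3]
    · simp [hs4, h4]
    · have := modPow_le m j
      simp [hw]
      omega
    · rintro s' ⟨hk', h11, h10, ho'⟩
      simp only [Function.update_self, ne_eq, Nat.reduceEqDiff, not_false_eq_true,
        Function.update_of_ne] at h11 h10 ho'
      refine ⟨⟨fun i hi => ?_, fun i hi => ?_⟩, by omega, ?_, ?_⟩
      · rw [hk'.nat i hi, ← hk.nat i hi]
        exact Function.update_of_ne (by omega) _ _
      · rw [hk'.field i hi, ← hk.field i hi]
      · rw [h10, hw, hs6, h6, modPow]
      · rw [ho', ho, hw, hk.field 0 (by norm_num), hk.field 1 (by norm_num),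
          hk.field 2 (by norm_num), List.range_succ, List.map_append, List.append_assoc]
        rfl
  · rintro s ⟨-, hN, -⟩
    omega
  · refine ⟨⟨fun i hi => ?_, fun _ _ => rfl⟩, by simp [h0, h4], by simp [modPow], by simp⟩
    simp only
    rw [Function.update_of_ne (by omega), Function.update_of_ne (by omega)]
  · rintro s ⟨hk, -, -, ho⟩
    refine ⟨hk, [curvePoint n m a b c], ?_, by simp⟩
    rw [ho]
    simp [curvePoint, List.ofFn_eq_map, ← List.map_coe_finRange_eq_range]

theorem halts_pointLoop {n G m : ℕ} (s₀ : RamState K) (h : s₀.Params n G m) (h9 : s₀.N 9 = G) :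
    Halts α (.whileNonzero 9 (.seq (.sub 9 9 3) (.seq (.felem 2 9) .point))) s₀
      (G * (n * (4 * m + 17) + 6) + 1) (fun s' => s₀.Keeps 9 2 s' ∧
        s₀.Emits {x | ∃ l < G, x = curvePoint n m (s₀.A 0) (s₀.A 1) (α l)} s') := by
  refine halts_countdown (B := n * (4 * m + 17) + 4)
    (fun l => {curvePoint n m (s₀.A 0) (s₀.A 1) (α l)}) s₀ (by norm_num) h.one h9 ?_
  intro l _ s hk hl
  have hp := h.of_keeps hk (by norm_num)
  refine (RamExec.halts_seq (.felem ..) (halts_point _ hp.n hp.one hp.zero hp.modulus)).mono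
    le_rfl ?_
  rintro s' ⟨hk', he⟩
  refine ⟨(s.keeps_update_field 10 2 _).trans hk' le_rfl le_rfl le_rfl (by norm_num), ?_⟩
  have h0 := hk.field 0 (by norm_num)
  have h1 := hk.field 1 (by norm_num)
  simp [hl, h0, h1] at he
  exact he

theorem halts_pointLoop₂ {n G m : ℕ} (s₀ : RamState K) (h : s₀.Params n G m) (h8 : s₀.N 8 = G) :
    Halts α (.whileNonzero 8 (.seq (.sub 8 8 3) (.seq (.felem 1 8) (.seq (.add 9 5 4)
      (.whileNonzero 9 (.seq (.sub 9 9 3) (.seq (.felem 2 9) .point))))))) s₀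
      (G * (G * (n * (4 * m + 17) + 6) + 5) + 1) (fun s' => s₀.Keeps 8 1 s' ∧
        s₀.Emits {x | ∃ j < G, ∃ l < G, x = curvePoint n m (s₀.A 0) (α j) (α l)} s') := by
  refine halts_countdown (B := G * (n * (4 * m + 17) + 6) + 3)
    (fun j => {x | ∃ l < G, x = curvePoint n m (s₀.A 0) (α j) (α l)}) s₀
    (by norm_num) h.one h8 ?_
  intro j _ s hk hj
  have hp := h.of_keeps hk (by norm_num)
  refine (RamExec.halts_seq (.felem ..) (RamExec.halts_seq (.add ..)
    (halts_pointLoop (G := G) _ ?_ ?_))).mono le_rfl ?_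
  · exact (hp.of_keeps (s.keeps_update_field 9 1 _) (by norm_num)).of_keeps
      (RamState.keeps_update_nat _ 9 1 _) (by norm_num)
  · simp [hp.bound, hp.zero]
  rintro s' ⟨hk', he⟩
  refine ⟨((s.keeps_update_field 9 1 (α (s.N 8))).trans (RamState.keeps_update_nat _ 9 1 _)
    le_rfl le_rfl le_rfl le_rfl).trans hk' le_rfl le_rfl le_rfl (by norm_num), ?_⟩
  have h0 := hk.field 0 (by norm_num)
  simp [hj, h0] at he
  exact he

theorem halts_pointLoop₃ {n G m : ℕ} (s₀ : RamState K) (h : s₀.Params n G m) (h7 : s₀.N 7 = G) :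
    Halts α (.whileNonzero 7 (.seq (.sub 7 7 3) (.seq (.felem 0 7) (.seq (.add 8 5 4)
      (.whileNonzero 8 (.seq (.sub 8 8 3) (.seq (.felem 1 8) (.seq (.add 9 5 4)
      (.whileNonzero 9 (.seq (.sub 9 9 3) (.seq (.felem 2 9) .point))))))))))) s₀
      (G * (G * (G * (n * (4 * m + 17) + 6) + 5) + 5) + 1) (fun s' => s₀.Keeps 7 0 s' ∧
        s₀.Emits {x | ∃ i < G, ∃ j < G, ∃ l < G,
          x = curvePoint n m (α i) (α j) (α l)} s') := by
  refine halts_countdown (B := G * (G * (n * (4 * m + 17) + 6) + 5) + 3)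
    (fun i => {x | ∃ j < G, ∃ l < G, x = curvePoint n m (α i) (α j) (α l)}) s₀
    (by norm_num) h.one h7 ?_
  intro j _ s hk hj
  have hp := h.of_keeps hk (by norm_num)
  refine (RamExec.halts_seq (.felem ..) (RamExec.halts_seq (.add ..)
    (halts_pointLoop₂ (G := G) _ ?_ ?_))).mono le_rfl ?_
  · exact (hp.of_keeps (s.keeps_update_field 8 0 _) (by norm_num)).of_keeps
      (RamState.keeps_update_nat _ 8 0 _) (by norm_num)
  · simp [hp.bound, hp.zero]
  rintro s' ⟨hk', he⟩
  refine ⟨((s.keeps_update_field 8 0 (α (s.N 7))).trans (RamState.keeps_update_nat _ 8 0 _)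
    le_rfl le_rfl le_rfl le_rfl).trans hk' le_rfl le_rfl le_rfl (by norm_num), ?_⟩
  simp [hj] at he
  exact he

theorem halts_allPoints {n G M : ℕ} (s₀ : RamState K) (h : s₀.Params n G M) :
    Halts α .allPoints s₀
      (M * (G * (G * (G * (n * (4 * M + 17) + 6) + 5) + 5) + 4) + 1) (fun s' =>
      s₀.Emits {x | ∃ m < M, ∃ i < G, ∃ j < G, ∃ l < G,
        x = curvePoint n m (α i) (α j) (α l)} s') := by
  refine (halts_countdown (q := 0) (B := G * (G * (G * (n * (4 * M + 17) + 6) + 5) + 5) + 2)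
    (fun m => {x | ∃ i < G, ∃ j < G, ∃ l < G, x = curvePoint n m (α i) (α j) (α l)}) s₀
    (by norm_num) h.one h.modulus ?_).mono le_rfl fun _ h => h.2
  intro m hm s hk hsm
  have hp : s.Params n G m :=
    ⟨(hk.nat 0 (by norm_num)).trans h.n, (hk.nat 3 (by norm_num)).trans h.one,
      (hk.nat 4 (by norm_num)).trans h.zero, (hk.nat 5 (by norm_num)).trans h.bound, hsm⟩
  refine (RamExec.halts_seq (.add ..) (halts_pointLoop₃ (G := G) _
    (hp.of_keeps (s.keeps_update_nat 7 0 _) le_rfl) ?_)).mono ?_ ?_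
  · simp [hp.bound, hp.zero]
  · have : G * (G * (G * (n * (4 * m + 17) + 6) + 5) + 5) ≤
        G * (G * (G * (n * (4 * M + 17) + 6) + 5) + 5) := by gcongr
    omega
  rintro s' ⟨hk', he⟩
  exact ⟨(s.keeps_update_nat 7 0 _).trans hk' le_rfl le_rfl le_rfl le_rfl, he⟩

theorem halts_addMul (s₀ : RamState K) (r x : ℕ) (h3 : s₀.N 3 = 1) (hr : r ≠ 12) (hr3 : r ≠ 3)
    (hx : x ≠ 12) (hxr : x ≠ r) :
    Halts α (.addMul r x) s₀ (s₀.N 12 * 3 + 1) (fun s' => s'.out = s₀.out ∧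
      (∀ i, i ≠ r → i ≠ 12 → s'.N i = s₀.N i) ∧ s'.N r = s₀.N r + s₀.N 12 * s₀.N x) := by
  refine (halts_whileNonzero (B := 2) (fun j s => s.out = s₀.out ∧
      (∀ i, i ≠ r → i ≠ 12 → s.N i = s₀.N i) ∧ s.N r = s₀.N r + j * s₀.N x ∧
      s.N 12 = s₀.N 12 - j) (s₀.N 12) ?_ ?_ ?_).mono le_rfl ?_
  · rintro j hj s ⟨ho, hk, hN, hc⟩
    have hs3 := hk 3 hr3.symm (by norm_num)
    have hsx := hk x hxr hx
    refine ⟨by omega, RamExec.halts_seq (.sub ..) (RamExec.halts (.add ..) ⟨ho, ?_, ?_, ?_⟩)⟩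
    · intro i hir hi
      rw [← hk i hir hi]
      simp only
      rw [Function.update_of_ne hir, Function.update_of_ne hi]
    · simp only [Function.update_self]
      rw [Function.update_of_ne hr, Function.update_of_ne hx, hN, hsx]
      ring
    · simp only
      rw [Function.update_of_ne hr.symm, Function.update_self]
      omega
  · rintro s ⟨-, -, -, hc⟩
    omega
  · exact ⟨rfl, fun _ _ _ => rfl, by simp, by omega⟩
  · rintro s ⟨ho, hk, hN, -⟩
    exact ⟨ho, hk, hN⟩

theorem halts_mulPow (s₀ : RamState K) (h3 : s₀.N 3 = 1) (h4 : s₀.N 4 = 0) :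
    Halts α .mulPow s₀ (s₀.N 10 * (s₀.N 0 * 3 + 5) + 1) (fun s' => s'.out = s₀.out ∧
      (∀ i, i ≠ 6 → (i < 10 ∨ 12 < i) → s'.N i = s₀.N i) ∧
      s'.N 6 = s₀.N 6 * (s₀.N 0 + 1) ^ s₀.N 10) := by
  refine (halts_whileNonzero (B := s₀.N 0 * 3 + 4) (fun j s => s.out = s₀.out ∧
      (∀ i, i ≠ 6 → (i < 10 ∨ 12 < i) → s.N i = s₀.N i) ∧
      s.N 6 = s₀.N 6 * (s₀.N 0 + 1) ^ j ∧ s.N 10 = s₀.N 10 - j) (s₀.N 10) ?_ ?_ ?_).mono le_rfl ?_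
  · rintro j hj s ⟨ho, hk, hN, hc⟩
    have hs0 := hk 0 (by norm_num) (by norm_num)
    have hs3 := hk 3 (by norm_num) (by norm_num)
    have hs4 := hk 4 (by norm_num) (by norm_num)
    refine ⟨by omega, (RamExec.halts_seq (.sub ..) (RamExec.halts_seq (.add ..)
      (RamExec.halts_seq (.add ..) (halts_addMul _ 6 11 ?_ (by norm_num) (by norm_num)
        (by norm_num) (by norm_num))))).mono ?_ ?_⟩
    · simp [hs3, h3]
    · simp [hs0, hs4, h4]
    · rintro s' ⟨ho', hk', hN'⟩
      refine ⟨ho'.trans ho, ?_, ?_, ?_⟩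
      · intro i hi6 hi
        rw [hk' i hi6 (by omega), ← hk i hi6 hi]
        simp only
        rw [Function.update_of_ne (by omega), Function.update_of_ne (by omega),
          Function.update_of_ne (by omega)]
      · simp only [ne_eq, Nat.reduceEqDiff, not_false_eq_true, Function.update_of_ne,
          Function.update_self, hs0, hs4, h4, hN] at hN'
        rw [hN']
        ring
      · rw [hk' 10 (by norm_num) (by norm_num)]
        simp [hs3, h3, hc]
        omega
  · rintro s ⟨-, -, -, hc⟩
    omega
  · exact ⟨rfl, fun _ _ _ => rfl, by simp, by omega⟩
  · rintro s ⟨ho, hk, hN, -⟩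
    exact ⟨ho, hk, hN⟩

/-- The loop finds the rounded-up logarithm by doubling `N[7]`, and builds the power with this
logarithm in the exponent one factor per round. -/
theorem halts_modulusLoop {n k d : ℕ} (s₀ : RamState K) (h0 : s₀.N 0 = n) (h3 : s₀.N 3 = 1)
    (h4 : s₀.N 4 = 0) (h6 : s₀.N 6 = 1) (h7 : s₀.N 7 = 1) (h8 : s₀.N 8 = d) (h9 : s₀.N 9 = k)
    (h13 : s₀.N 13 = k + 1) :
    Halts α .modulusLoop s₀ (Nat.clog 2 (k + 1) * (d * (n * 3 + 5) + 5) + 1) (fun s' =>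
      s'.out = s₀.out ∧ s'.N 0 = n ∧ s'.N 3 = 1 ∧ s'.N 4 = 0 ∧
      s'.N 6 = (n + 1) ^ (d * Nat.clog 2 (k + 1))) := by
  refine (halts_whileNonzero (B := d * (n * 3 + 5) + 4) (fun j s => s.out = s₀.out ∧
      s.N 0 = n ∧ s.N 3 = 1 ∧ s.N 4 = 0 ∧ s.N 6 = (n + 1) ^ (d * j) ∧ s.N 7 = 2 ^ j ∧
      s.N 8 = d ∧ s.N 9 = k + 1 - 2 ^ j ∧ s.N 13 = k + 1) (Nat.clog 2 (k + 1)) ?_ ?_ ?_).mono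
      le_rfl ?_
  · rintro j hj s ⟨ho, h0, h3, h4, h6, h7, h8, h9, h13⟩
    have hlt : 2 ^ j < k + 1 := (Nat.lt_clog_iff_pow_lt (by norm_num)).1 hj
    refine ⟨by omega, (RamExec.halts_seq (.add ..) (Halts.seq (halts_mulPow _ ?_ ?_)
      (B' := 2) (R := fun s => s.out = s₀.out ∧
      s.N 0 = n ∧ s.N 3 = 1 ∧ s.N 4 = 0 ∧ s.N 6 = (n + 1) ^ (d * (j + 1)) ∧ s.N 7 = 2 ^ (j + 1) ∧
      s.N 8 = d ∧ s.N 9 = k + 1 - 2 ^ (j + 1) ∧ s.N 13 = k + 1) ?_)).mono ?_ fun _ => id⟩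
    · simp [h3]
    · simp [h4]
    · rintro s' ⟨ho', hk', hN'⟩
      have e0 := hk' 0 (by norm_num) (by norm_num)
      have e3 := hk' 3 (by norm_num) (by norm_num)
      have e4 := hk' 4 (by norm_num) (by norm_num)
      have e7 := hk' 7 (by norm_num) (by norm_num)
      have e8 := hk' 8 (by norm_num) (by norm_num)
      have e13 := hk' 13 (by norm_num) (by norm_num)
      simp only [ne_eq, Nat.reduceEqDiff, not_false_eq_true, Function.update_of_ne,
          Function.update_self, OfNat.zero_ne_ofNat,
          h0, h3, h4, h6, h7, h8, h13, add_zero] at e0 e3 e4 e7 e8 e13 hN'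
      refine RamExec.halts_seq (.add ..) (RamExec.halts (.sub ..) ⟨ho'.trans ho, ?_⟩)
      simp [e0, e3, e4, e7, e8, e13, hN', pow_succ, mul_two, mul_add, pow_add]
    · simp [h0, h4, h8]
  · rintro s ⟨-, -, -, -, -, -, -, h9, -⟩
    have : k + 1 ≤ 2 ^ Nat.clog 2 (k + 1) := Nat.le_pow_clog (by norm_num) _
    omega
  · exact ⟨rfl, h0, h3, h4, by simpa using h6, by simpa using h7, h8, by simp [h9], h13⟩
  · rintro s ⟨ho, h0, h3, h4, h6, -⟩
    exact ⟨ho, h0, h3, h4, h6⟩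

theorem halts_bounds (n k δ : ℕ) :
    Halts α .bounds (RamState.initial K n k δ)
      (Nat.clog 2 (k + 1) * (8 * δ * (n * 3 + 5) + 5) + 3 * n + 12) (fun s' =>
      s'.out = [] ∧ s'.Params n ((n + 1) * (n + 1) ^ (8 * δ * Nat.clog 2 (k + 1)))
        ((n + 1) ^ (8 * δ * Nat.clog 2 (k + 1)))) := by
  have hd : δ + δ + (δ + δ) + (δ + δ + (δ + δ)) = 8 * δ := by ring
  refine (RamExec.halts_seq (.const ..) (RamExec.halts_seq (.add ..) (RamExec.halts_seq (.add ..)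
    (RamExec.halts_seq (.add ..) (RamExec.halts_seq (.const ..) (RamExec.halts_seq (.add ..)
    (RamExec.halts_seq (.const ..) (RamExec.halts_seq (.sub ..)
    ((halts_modulusLoop (n := n) (k := k) (d := 8 * δ) _ ?_ ?_ ?_ ?_ ?_ ?_ ?_ ?_).seq
    (B' := 3 * n + 3) (R := fun s' =>
      s'.out = [] ∧ s'.Params n ((n + 1) * (n + 1) ^ (8 * δ * Nat.clog 2 (k + 1)))
        ((n + 1) ^ (8 * δ * Nat.clog 2 (k + 1)))) ?_))))))))).mono (by omega) fun _ => id
  any_goals simp [RamState.initial, hd]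
  intro s ho h0 h3 h4 h6
  refine (RamExec.halts_seq (.add ..) (RamExec.halts_seq (.add ..) (halts_addMul _ 5 6 ?_
    (by norm_num) (by norm_num) (by norm_num) (by norm_num)))).mono ?_ ?_
  · simp [h3]
  · simp [h0, h4]
    omega
  · rintro s' ⟨ho', hk', hN'⟩
    have e0 := hk' 0 (by norm_num) (by norm_num)
    have e3 := hk' 3 (by norm_num) (by norm_num)
    have e4 := hk' 4 (by norm_num) (by norm_num)
    have e6 := hk' 6 (by norm_num) (by norm_num)
    simp [h0, h3, h4, h6] at e0 e3 e4 e6 hN'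
    refine ⟨ho'.trans ho, e0, e3, e4, ?_, e6⟩
    rw [hN']
    ring

/-- The output and the running time of the program. -/
theorem halts_hittingSet (n k δ : ℕ) :
    Halts α .hittingSet (RamState.initial K n k δ)
      (Nat.clog 2 (k + 1) * (8 * δ * (n * 3 + 5) + 5) + 3 * n + 12 +
        ((n + 1) ^ (8 * δ * Nat.clog 2 (k + 1)) *
          ((n + 1) * (n + 1) ^ (8 * δ * Nat.clog 2 (k + 1)) *
            ((n + 1) * (n + 1) ^ (8 * δ * Nat.clog 2 (k + 1)) *
              ((n + 1) * (n + 1) ^ (8 * δ * Nat.clog 2 (k + 1)) *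
                (n * (4 * (n + 1) ^ (8 * δ * Nat.clog 2 (k + 1)) + 17) + 6) + 5) + 5) + 4) + 1))
      (fun s' => ∃ H : List (Fin n → K), s'.out = (H.map List.ofFn).flatten ∧
        ∀ m < (n + 1) ^ (8 * δ * Nat.clog 2 (k + 1)),
        ∀ i < (n + 1) * (n + 1) ^ (8 * δ * Nat.clog 2 (k + 1)),
        ∀ j < (n + 1) * (n + 1) ^ (8 * δ * Nat.clog 2 (k + 1)),
        ∀ l < (n + 1) * (n + 1) ^ (8 * δ * Nat.clog 2 (k + 1)),
        curvePoint n m (α i) (α j) (α l) ∈ H) := by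
  refine (halts_bounds n k δ).seq fun s ⟨ho, hp⟩ => (halts_allPoints s hp).mono le_rfl ?_
  rintro s' ⟨H, hH, hm⟩
  refine ⟨H, by rw [hH, ho, List.nil_append], fun m hm' i hi j hj l hl => ?_⟩
  exact hm _ ⟨m, hm', i, hi, j, hj, l, hl, rfl⟩

end Programs

/-! ### Nonvanishing at a point of the list -/

theorem exists_eval_ne_zero {K : Type*} [Field K] {α : ℕ → K} {G : ℕ}
    (hα : Set.InjOn α {i | i < G}) {p : Polynomial K} (hp : p ≠ 0) (hdeg : p.natDegree < G) :
    ∃ i < G, p.eval (α i) ≠ 0 := by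
  classical
  by_contra! h
  refine hp (Polynomial.eq_zero_of_natDegree_lt_card_of_eval_eq_zero' p
    ((Finset.range G).image α) ?_ ?_)
  · intro x hx
    obtain ⟨i, hi, rfl⟩ := Finset.mem_image.1 hx
    exact h i (Finset.mem_range.1 hi)
  · rwa [Finset.card_image_of_injOn (by simpa [Set.InjOn] using hα), Finset.card_range]

open Polynomial in
-- This is the Taylor expansion at `r ↦ a ^ w r`, evaluated at the displacement `b * c ^ w r`: in it
-- `b` records the size of a monomial and `c` its weight.
theorem sum_mul_prod_curve {σ K : Type*} [DecidableEq σ] [Fintype σ] [Field K] (w : σ → ℕ)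
    (f : Finset σ → K) (a b c : K) :
    ∑ U, f U * ∏ r ∈ U, (a ^ w r + b * c ^ w r) =
      ∑ S, (shiftCoeff w Finset.univ (fun U => C (f U)) S).eval a * c ^ (∑ r ∈ S, w r) *
        b ^ S.card := by
  have h1 : ∀ U : Finset σ, f U * ∏ r ∈ U, (a ^ w r + b * c ^ w r) = ∑ S ∈ U.powerset,
      f U * (a ^ (∑ r ∈ U \ S, w r) * c ^ (∑ r ∈ S, w r) * b ^ S.card) := by
    intro U
    rw [Finset.prod_congr rfl fun r _ => add_comm _ _, Finset.prod_add, Finset.mul_sum]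
    refine Finset.sum_congr rfl fun S _ => ?_
    rw [Finset.prod_mul_distrib, Finset.prod_const, Finset.prod_pow_eq_pow_sum,
      Finset.prod_pow_eq_pow_sum]
    ring
  simp only [h1]
  rw [Finset.sum_comm' (t' := Finset.univ) (s' := fun S => Finset.univ.filter (S ⊆ ·))
    (by simp)]
  refine Finset.sum_congr rfl fun S _ => ?_
  rw [shiftCoeff, eval_finsetSum, Finset.sum_mul, Finset.sum_mul]
  symm
  refine Finset.sum_nbij' (fun V => S ∪ V) (fun U => U \ S) ?_ ?_ ?_ ?_ ?_
  · intro V _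
    simp
  · intro U _
    rw [Finset.mem_powerset]
    exact Finset.sdiff_subset_sdiff (Finset.subset_univ _) le_rfl
  · intro V hV
    rw [Finset.mem_powerset, Finset.subset_sdiff] at hV
    exact Finset.union_sdiff_cancel_left hV.2.symm
  · intro U hU
    exact Finset.union_sdiff_of_subset (Finset.mem_filter.1 hU).2
  · intro V hV
    rw [Finset.mem_powerset, Finset.subset_sdiff] at hV
    rw [Finset.union_sdiff_cancel_left hV.2.symm]
    simp only [eval_mul, eval_C, eval_pow, eval_X]
    ring

open Polynomial in
/-- A multilinear polynomial with a nonzero derivative of low order at `r ↦ X ^ w r` is nonzero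
at some point `a ^ w r + b * c ^ w r`. -/
theorem exists_curve_point_ne_zero {σ K : Type*} [DecidableEq σ] [Fintype σ] [Field K]
    {α : ℕ → K} {G M s : ℕ} (hα : Set.InjOn α {i | i < G}) (w : σ → ℕ) (hwM : ∀ r, w r ≤ M)
    (hG : Fintype.card σ * M < G) (hG' : Fintype.card σ < G)
    (hw : ∀ U V : Finset σ, U.card ≤ s → V.card ≤ s → ∑ r ∈ U, w r = ∑ r ∈ V, w r → U = V)
    (f : Finset σ → K) {T : Finset σ} (hT : T.card ≤ s)
    (hne : shiftCoeff w Finset.univ (fun U => C (f U)) T ≠ 0) :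
    ∃ i < G, ∃ j < G, ∃ l < G,
      ∑ U, f U * ∏ r ∈ U, (α i ^ w r + α j * α l ^ w r) ≠ 0 := by
  have hsum : ∀ U : Finset σ, ∑ r ∈ U, w r ≤ Fintype.card σ * M := fun U =>
    (Finset.sum_le_card_nsmul U w M fun r _ => hwM r).trans
      (by rw [smul_eq_mul]; exact Nat.mul_le_mul_right _ (Finset.card_le_univ U))
  have hdeg : ∀ (t : Finset (Finset σ)) (g : Finset σ → K) (e : Finset σ → ℕ) (N : ℕ),
      (∀ S, e S ≤ N) → (∑ S ∈ t, C (g S) * X ^ e S).natDegree ≤ N := fun t g e N he =>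
    natDegree_sum_le_of_forall_le _ _ fun S _ => (natDegree_C_mul_X_pow_le _ _).trans (he S)
  obtain ⟨i, hi, hgi⟩ := exists_eval_ne_zero hα hne ((hdeg _ _ _ _ hsum).trans_lt hG)
  set g : Finset σ → K := fun S =>
    (shiftCoeff w Finset.univ (fun U => C (f U)) S).eval (α i) with hg
  -- Among the sets of the size of `T`, only `T` has its weight, so this polynomial in `c` has a
  -- nonzero coefficient.
  have hcne : ∑ S ∈ Finset.univ.filter (fun S : Finset σ => S.card = T.card),
      C (g S) * X ^ (∑ r ∈ S, w r) ≠ 0 := by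
    intro h0
    apply hgi
    have := congrArg (fun p => p.coeff (∑ r ∈ T, w r)) h0
    simp only [finsetSum_coeff, coeff_C_mul_X_pow, coeff_zero] at this
    rw [Finset.sum_eq_single T] at this
    · simpa using this
    · intro S hS hST
      rw [if_neg]
      intro h
      exact hST (hw S T (by rw [(Finset.mem_filter.1 hS).2]; exact hT) hT h.symm)
    · simp
  obtain ⟨l, hl, hgl⟩ := exists_eval_ne_zero hα hcne ((hdeg _ _ _ _ hsum).trans_lt hG)
  -- As a polynomial in `b`, its coefficient at the size of `T` is the value just made nonzero.
  have hbne : ∑ S : Finset σ, C (g S * α l ^ (∑ r ∈ S, w r)) * X ^ S.card ≠ 0 := by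
    intro h0
    apply hgl
    have := congrArg (fun p => p.coeff T.card) h0
    simp only [finsetSum_coeff, coeff_C_mul_X_pow, coeff_zero] at this
    rw [← this, eval_finsetSum, Finset.sum_filter]
    refine Finset.sum_congr rfl fun S _ => ?_
    by_cases h : S.card = T.card
    · simp [h]
    · simp [h, Ne.symm h]
  obtain ⟨j, hj, hgj⟩ := exists_eval_ne_zero hα hbne
    ((hdeg _ _ _ _ Finset.card_le_univ).trans_lt hG')
  refine ⟨i, hi, j, hj, l, hl, ?_⟩
  rw [sum_mul_prod_curve]
  simpa [eval_finsetSum] using hgj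

theorem isHittingSet_of_curvePoint_mem {F : Type u} [Field F] {K : Type v} [Field K] [Algebra F K]
    {n k δ h M G : ℕ} (hn : 1 ≤ n) (hδ : 1 ≤ δ) (hh : 1 ≤ h) (hk : k < 2 ^ h)
    (hM : (n + 1) ^ (8 * δ * h) ≤ M) (hG : n * M < G) {α : ℕ → K}
    (hα : Set.InjOn α {i | i < G}) {H : Set (Fin n → K)}
    (hH : ∀ m < M, ∀ i < G, ∀ j < G, ∀ l < G, curvePoint n m (α i) (α j) (α l) ∈ H) :
    IsHittingSet F k δ H := by
  classical
  intro D _ hD hne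
  obtain ⟨q, g, hq, hg, hpoly⟩ := D.exists_factorsAlong hδ hD
  have hδh : 1 ≤ δ * h := Nat.mul_pos hδ hh
  have hhδ : h ≤ δ * h := Nat.le_mul_of_pos_left _ hδ
  -- The support bound is that of `sum_eq_zero_of_shiftCoeff_eq_zero` with `m = h`: one term for the
  -- base case and `δ + 1` for each of `h` halvings. Twice this plus two is at most `8 * δ * h`.
  obtain ⟨p, hp0, hp, hsep⟩ := exists_separating_modulus n (δ * h + (δ + 1) * h) hn (by omega)
  have hpM : p ≤ M := by
    refine hp.trans ((Nat.pow_le_pow_right (by omega) ?_).trans hM)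
    rw [add_mul, mul_assoc]
    omega
  obtain ⟨m, rfl⟩ : ∃ m, p = m + 1 := ⟨p - 1, by omega⟩
  let w : Fin n → ℕ := fun r => modPow m r
  have hw : ∀ U V : Finset (Fin n), U.card ≤ δ * h + (δ + 1) * h →
      V.card ≤ δ * h + (δ + 1) * h → ∑ r ∈ U, w r = ∑ r ∈ V, w r → U = V := by
    intro U V hU hV hUV
    have hmod : ∀ U : Finset (Fin n), ∑ r ∈ U, 2 ^ r.val ≡ ∑ r ∈ U, w r [MOD m + 1] := fun U =>
      Nat.ModEq.sum fun r _ => (modPow_modEq m r).symm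
    exact hsep U V hU hV ((hmod U).trans (hUV ▸ (hmod V).symm))
  let f : Finset (Fin n) → K := fun U => ∑ i, algebraMap F K (g i U)
  obtain ⟨T, hT, hTne⟩ : ∃ T : Finset (Fin n), T.card ≤ δ * h + (δ + 1) * h ∧
      shiftCoeff w Finset.univ (fun U => Polynomial.C (f U)) T ≠ 0 := by
    by_contra! hcon
    apply hne
    rw [hpoly]
    refine Finset.sum_eq_zero fun U _ => ?_
    have h0 := sum_eq_zero_of_shiftCoeff_eq_zero w (δ := δ) (m := h)
      (fun U V hU hV => hw U V (by omega) (by omega)) (by simpa using hk) q hq h 0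
      (fun i : Fin k => (i : ℕ)) (fun i U => algebraMap F K (g i U))
      (fun i => ⟨Nat.zero_le _, by have := i.2; omega⟩) (fun i => (hg i).map _) hcon U
    rw [← map_sum, map_eq_zero] at h0
    rw [h0]
    simp
  have hwM : ∀ r, w r ≤ M := fun r => (modPow_le m r).trans hpM
  obtain ⟨i, hi, j, hj, l, hl, hx⟩ := exists_curve_point_ne_zero hα w hwM
    (by simpa using hG) (by
      rw [Fintype.card_fin]
      exact (Nat.le_mul_of_pos_right n (by omega)).trans_lt hG) hw f hT hTne
  refine ⟨_, hH m (by omega) i hi j hj l hl, ?_⟩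
  rw [hpoly]
  simpa [f, w, curvePoint, map_sum, map_mul, map_prod] using hx

/-! ### Choice of the constants -/

/-- The leading term is `M * G ^ 3 * (n * M)` up to a constant, and both `M` and `n * M` are at most
`G`. Since `2 ≤ G`, lower powers of `G` are absorbed by higher ones. -/
theorem running_time_le {n d h M G : ℕ} (hG : G = (n + 1) * M) (hh : h ≤ M) (hd : d ≤ M)
    (hn : 1 ≤ n) (hM : 1 ≤ M) :
    h * (d * (n * 3 + 5) + 5) + 3 * n + 12 +
      (M * (G * (G * (G * (n * (4 * M + 17) + 6) + 5) + 5) + 4) + 1) ≤ 2 ^ 8 * G ^ 5 := by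
  have hnM : n * M ≤ G := by rw [hG]; exact Nat.mul_le_mul_right _ (by omega)
  have hMG : M ≤ G := by rw [hG]; exact Nat.le_mul_of_pos_left _ (by omega)
  have hnG : n + 1 ≤ G := by rw [hG]; exact Nat.le_mul_of_pos_right _ hM
  have h2 : 2 ≤ G := by omega
  have p2 : 2 * G ≤ G ^ 2 := by rw [sq]; exact Nat.mul_le_mul_right _ h2
  have p3 : 2 * G ^ 2 ≤ G ^ 3 := by rw [pow_succ G 2, mul_comm]; exact Nat.mul_le_mul_left _ h2
  have p4 : 2 * G ^ 3 ≤ G ^ 4 := by rw [pow_succ G 3, mul_comm]; exact Nat.mul_le_mul_left _ h2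
  have p5 : 2 * G ^ 4 ≤ G ^ 5 := by rw [pow_succ G 4, mul_comm]; exact Nat.mul_le_mul_left _ h2
  have a1 : n * (4 * M + 17) + 6 ≤ 24 * G := by
    have : n * (4 * M + 17) = 4 * (n * M) + 17 * n := by ring
    omega
  have a2 : G * (n * (4 * M + 17) + 6) ≤ 24 * G ^ 2 :=
    (Nat.mul_le_mul_left G a1).trans_eq (by ring)
  have a3 : G * (G * (n * (4 * M + 17) + 6) + 5) ≤ 27 * G ^ 3 :=
    (Nat.mul_le_mul_left G (show _ ≤ 27 * G ^ 2 by omega)).trans_eq (by ring)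
  have a4 : G * (G * (G * (n * (4 * M + 17) + 6) + 5) + 5) ≤ 30 * G ^ 4 :=
    (Nat.mul_le_mul_left G (show _ ≤ 30 * G ^ 3 by omega)).trans_eq (by ring)
  have a5 : M * (G * (G * (G * (n * (4 * M + 17) + 6) + 5) + 5) + 4) ≤ 31 * G ^ 5 :=
    (Nat.mul_le_mul hMG (show _ ≤ 31 * G ^ 4 by omega)).trans_eq (by ring)
  have b1 : d * (n * 3 + 5) ≤ 5 * G ^ 2 :=
    (Nat.mul_le_mul (hd.trans hMG) (show n * 3 + 5 ≤ 5 * G by omega)).trans_eq (by ring)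
  have b2 : h * (d * (n * 3 + 5) + 5) ≤ 7 * G ^ 3 :=
    (Nat.mul_le_mul (hh.trans hMG) (show _ ≤ 7 * G ^ 2 by omega)).trans_eq (by ring)
  omega

theorem theorem1 :
    ∃ (p : RamProg) (c : ℕ), ∀ n k δ : ℕ, 1 ≤ n → 1 ≤ k → 1 ≤ δ →
      ∀ (K : Type v) [Field K] (α : ℕ → K),
        Set.InjOn α {i | i < (n + 1) ^ (c * δ * Nat.log 2 (k + 1))} →
        ∃ H : List (Fin n → K),
          OutputsPointsWithin α p n k δ ((n + 1) ^ (c * δ * Nat.log 2 (k + 1))) H ∧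
          ∀ (F : Type u) [Field F] [Algebra F K], IsHittingSet F k δ {x | x ∈ H} := by
  -- Here `93 = 8 + 5 + 2 * 40`: the constant `2 ^ 8`, the five factors `n + 1` in the fifth power
  -- of `(n + 1) * M`, and the fifth power of `M`, doubled because `clog` is at most twice `log`.
  refine ⟨.hittingSet, 93, fun n k δ hn hk hδ K _ α hα => ?_⟩
  obtain ⟨t, s, ht, hrun, H, hout, hH⟩ := halts_hittingSet (α := α) n k δ
  set h := Nat.clog 2 (k + 1) with hh
  set L := Nat.log 2 (k + 1) with hL
  set M := (n + 1) ^ (8 * δ * h) with hM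
  have hL1 : 1 ≤ L := Nat.log_pos (by norm_num) (by omega)
  have hhL : h ≤ 2 * L := by
    have : h ≤ L + 1 := Nat.clog_le_of_le_pow (Nat.lt_pow_succ_log_self (by norm_num) _).le
    omega
  have hkh : k < 2 ^ h := Nat.le_pow_clog (by norm_num) (k + 1)
  have hh1 : 1 ≤ h := Nat.clog_pos (by norm_num) (by omega)
  have hM1 : 1 ≤ M := Nat.one_le_pow _ _ (by omega)
  have hpow : ∀ x, x ≤ 8 * δ * h → x ≤ M := fun x hx =>
    (Nat.lt_two_pow_self (n := x)).le.trans ((Nat.pow_le_pow_left (show 2 ≤ n + 1 by omega) x).trans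
      (Nat.pow_le_pow_right (by omega) hx))
  have hhM : h ≤ M := hpow h (Nat.le_mul_of_pos_left _ (by omega))
  have hdM : 8 * δ ≤ M := hpow _ (Nat.le_mul_of_pos_right _ hh1)
  have hδh : δ * h ≤ 2 * (δ * L) := (Nat.mul_le_mul_left δ hhL).trans_eq (by ring)
  have hδL : 1 ≤ δ * L := Nat.mul_pos hδ hL1
  have hT : 2 ^ 8 * ((n + 1) * M) ^ 5 ≤ (n + 1) ^ (93 * δ * L) := by
    calc 2 ^ 8 * ((n + 1) * M) ^ 5 ≤ (n + 1) ^ 8 * ((n + 1) * M) ^ 5 :=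
          Nat.mul_le_mul_right _ (Nat.pow_le_pow_left (by omega) 8)
      _ = (n + 1) ^ (13 + 40 * (δ * h)) := by
          rw [hM, mul_pow, ← pow_mul, ← mul_assoc, ← pow_add, ← pow_add]
          congr 1
          ring
      _ ≤ (n + 1) ^ (93 * δ * L) := by
          refine Nat.pow_le_pow_right (by omega) ?_
          rw [mul_assoc]
          omega
  have hGT : (n + 1) * M ≤ (n + 1) ^ (93 * δ * L) := by
    refine le_trans ?_ hT
    exact (Nat.le_self_pow (by norm_num) _).trans (Nat.le_mul_of_pos_left _ (by norm_num))
  refine ⟨H, ⟨t, s, ht.trans ((running_time_le rfl hhM hdM hn hM1).trans hT), hrun, hout⟩, ?_⟩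
  intro F _ _
  refine isHittingSet_of_curvePoint_mem hn hδ hh1 hkh le_rfl (G := (n + 1) * M) ?_
    (hα.mono fun i hi => lt_of_lt_of_le hi hGT) hH
  exact Nat.mul_lt_mul_of_pos_right (by omega) hM1
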